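/- Let $\mathbb Z_+=\{1,2,3,\dots\}$. There is a universal constant $C>0$ such that the following holds. Let $a(n)$ ($n\ge 0$) and $b(n)$ ($n\ge 1$) be real numbers with $a(n)\neq 0$ for all $n$, $a(0)=1$ and $\sum_{n}|a(n)|^{-1}=\infty$. Let $H_+$ be the self-adjoint operator on $\ell^2(\mathbb Z_+)$ given by $$(H_+u)(n)=a(n)u(n+1)+a(n-1)u(n-1)+b(n)u(n),\qquad n\ge 1,\quad u(0):=0,$$ on the domain of all $u\in\ell^2(\mathbb Z_+)$ for which the right-hand side is in $\ell^2(\mathbb Z_+)$. Let $\delta_1$ be the first unit vector, $\mu^+$ the spectral measure of $H_+$ for $\delta_1$, and $P_S$ the spectral projection of $H_+$ on a Borel set $S\subset\mathbb R$. For $E,\theta\in\mathbb R$ let $u_\theta(\cdot,E)$ be the solution of $$a(n)u(n+1)+a(n-1)u(n-1)+b(n)u(n)=E\,u(n),\qquad n\ge 1,$$ with $u_\theta(0,E)=\sin\theta$ and $u_\theta(1,E)=\cos\theta$. For $L\ge 0$ put $$\|\phi\|_L^2=\sum_{n=1}^{\lfloor L\rfloor}|\phi(n)|^2+(L-\lfloor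 L\rfloor)\,|\phi(\lfloor L\rfloor+1)|^2 ,$$ and for $\epsilon>0$ let $L_\epsilon^+(E)\ge 0$ be the unique number $L$ with $$\max_\theta\|u_\theta(\cdot,E)\|_{L}\cdot\min_\theta\|u_\theta(\cdot,E)\|_{L}=\epsilon^{-1}.$$ Then for every Borel set $S\subset\mathbb R$, every $T>0$ and every $L>0$, $$\frac2T\int_0^\infty e^{-2t/T}\,\big\|e^{-iH_+t}P_S\delta_1\big\|_L^2\,dt\;\le\; C\int_S\frac{\|u_0(\cdot,E)\|_L^2}{\|u_0(\cdot,E)\|^2_{L^+_{1/T}(E)}}\,d\mu^+(E).$$ -/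

import Mathlib

open MeasureTheory Filter Topology
open scoped ENNReal

noncomputable section

namespace JacobiDynamics

/-! ### Bounded Borel functions of a self-adjoint operator -/

section Calculus

variable {𝓗 : Type*} [NormedAddCommGroup 𝓗] [InnerProductSpace ℂ 𝓗] [CompleteSpace 𝓗]

/-- A bounded Borel function on the real line. -/
def IsBoundedBorel (f : ℝ → ℂ) : Prop := Measurable f ∧ ∃ M : ℝ, ∀ x, ‖f x‖ ≤ M

/-- `Φ` is the functional calculus `f ↦ f(A)` of the (possibly unbounded) operator `A` for bounded
Borel functions: a contractive star-homomorphism into the bounded operators which turns bounded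
pointwise limits into strong limits and which sends the identity function, approximated by bounded
Borel functions, to `A`. By the spectral theorem there is, for self-adjoint `A`, exactly one such
`Φ` on the bounded Borel functions. -/
structure IsBorelFunctionalCalculus (A : 𝓗 →ₗ.[ℂ] 𝓗) (Φ : (ℝ → ℂ) → 𝓗 →L[ℂ] 𝓗) : Prop where
  map_one : Φ (fun _ => 1) = 1
  map_add : ∀ f g, IsBoundedBorel f → IsBoundedBorel g →
    Φ (fun x => f x + g x) = Φ f + Φ g
  map_smul : ∀ (c : ℂ) (f), IsBoundedBorel f → Φ (fun x => c * f x) = c • Φ f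
  map_mul : ∀ f g, IsBoundedBorel f → IsBoundedBorel g →
    Φ (fun x => f x * g x) = Φ f * Φ g
  map_conj : ∀ f, IsBoundedBorel f →
    Φ (fun x => (starRingEnd ℂ) (f x)) = ContinuousLinearMap.adjoint (Φ f)
  norm_le : ∀ (f) (M : ℝ), Measurable f → (∀ x, ‖f x‖ ≤ M) → ‖Φ f‖ ≤ M
  tendsto_of_bounded : ∀ (h : ℕ → ℝ → ℂ) (f : ℝ → ℂ) (M : ℝ),
    (∀ n, Measurable (h n)) → Measurable f → (∀ n x, ‖h n x‖ ≤ M) →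
    (∀ x, Tendsto (fun n => h n x) atTop (𝓝 (f x))) →
    ∀ ψ : 𝓗, Tendsto (fun n => Φ (h n) ψ) atTop (𝓝 (Φ f ψ))
  tendsto_operator : ∀ h : ℕ → ℝ → ℂ,
    (∀ n, IsBoundedBorel (h n)) → (∀ n x, ‖h n x‖ ≤ |x|) →
    (∀ x : ℝ, Tendsto (fun n => h n x) atTop (𝓝 (x : ℂ))) →
    ∀ ψ : A.domain, Tendsto (fun n => Φ (h n) (ψ : 𝓗)) atTop (𝓝 (A ψ))

open Classical in
/-- The bounded operator `f(A)`, for a self-adjoint operator `A` and a bounded Borel function `f`. -/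
def borelCalculus (A : 𝓗 →ₗ.[ℂ] 𝓗) : (ℝ → ℂ) → 𝓗 →L[ℂ] 𝓗 :=
  if h : ∃ Φ, IsBorelFunctionalCalculus A Φ then h.choose else fun _ => 0

/-- The time evolution `e^{-itA}`. -/
def evolution (A : 𝓗 →ₗ.[ℂ] 𝓗) (t : ℝ) : 𝓗 →L[ℂ] 𝓗 :=
  borelCalculus A (fun x => Complex.exp (-Complex.I * t * x))

/-- The spectral projection `P_S = 1_S(A)`. -/
def spectralProjection (A : 𝓗 →ₗ.[ℂ] 𝓗) (S : Set ℝ) : 𝓗 →L[ℂ] 𝓗 :=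
  borelCalculus A (S.indicator fun _ => 1)

theorem isBoundedBorel_indicator {S : Set ℝ} (hS : MeasurableSet S) :
    IsBoundedBorel (S.indicator fun _ => 1) := by
  refine ⟨measurable_const.indicator hS, 1, fun x => ?_⟩
  by_cases hx : x ∈ S <;> simp [hx]

theorem inner_spectralProjection_nonneg (A : 𝓗 →ₗ.[ℂ] 𝓗) (ψ : 𝓗) {S : Set ℝ}
    (hS : MeasurableSet S) : 0 ≤ (inner ℂ ψ (spectralProjection A S ψ)).re := by
  unfold spectralProjection borelCalculus
  split_ifs with h
  · have hΦ := h.choose_spec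
    set Φ := h.choose
    have hb := isBoundedBorel_indicator hS
    have h1 : (fun x => S.indicator (fun _ => (1 : ℂ)) x * S.indicator (fun _ => 1) x)
        = S.indicator fun _ => 1 := by
      funext x; by_cases hx : x ∈ S <;> simp [hx]
    have h2 : (fun x => (starRingEnd ℂ) (S.indicator (fun _ => (1 : ℂ)) x))
        = S.indicator fun _ => 1 := by
      funext x; by_cases hx : x ∈ S <;> simp [hx]
    have h3 := hΦ.map_mul _ _ hb hb
    have h4 := hΦ.map_conj _ hb
    rw [h1] at h3
    rw [h2] at h4
    rw [h3, mul_apply_eq_comp]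
    nth_rewrite 1 [h4]
    rw [ContinuousLinearMap.adjoint_inner_right]
    exact inner_self_nonneg (𝕜 := ℂ)
  · simp

theorem hasSum_inner_spectralProjection (A : 𝓗 →ₗ.[ℂ] 𝓗) (ψ : 𝓗) (S : ℕ → Set ℝ)
    (hS : ∀ i, MeasurableSet (S i)) (hd : Pairwise (Function.onFun Disjoint S)) :
    Tendsto (fun n => ∑ i ∈ Finset.range n, (inner ℂ ψ (spectralProjection A (S i) ψ)).re) atTop
      (𝓝 (inner ℂ ψ (spectralProjection A (⋃ i, S i) ψ)).re) := by
  unfold spectralProjection borelCalculus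
  split_ifs with h
  · have hΦ := h.choose_spec
    set Φ := h.choose
    have hfin : ∀ n, (∑ i ∈ Finset.range n, Φ ((S i).indicator fun _ => 1))
        = Φ ((⋃ i ∈ Finset.range n, S i).indicator fun _ => 1) := by
      intro n
      induction n with
      | zero =>
        have := hΦ.map_smul 0 (fun _ => 1) ⟨measurable_const, 1, by simp⟩
        simp only [zero_mul, zero_smul] at this
        simpa using this.symm
      | succ n ih =>
        rw [Finset.sum_range_succ, ih, ← hΦ.map_add _ _
          (isBoundedBorel_indicator (Finset.measurableSet_biUnion _ fun i _ => hS i))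
          (isBoundedBorel_indicator (hS n))]
        have hdis : Disjoint (⋃ i ∈ Finset.range n, S i) (S n) := by
          simp only [Set.disjoint_iUnion_left]
          intro i hi
          exact hd (by simp at hi; omega)
        congr 1
        rw [Finset.range_add_one, Finset.set_biUnion_insert, Set.union_comm,
          Set.indicator_union_of_disjoint hdis]
    have hlim := hΦ.tendsto_of_bounded
      (fun n => (⋃ i ∈ Finset.range n, S i).indicator fun _ => 1)
      ((⋃ i, S i).indicator fun _ => 1) 1
      (fun n => (isBoundedBorel_indicator
        (Finset.measurableSet_biUnion _ fun i _ => hS i)).1)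
      (isBoundedBorel_indicator (MeasurableSet.iUnion hS)).1
      (fun n x => by
        by_cases hx : x ∈ ⋃ i ∈ Finset.range n, S i
        · rw [Set.indicator_of_mem hx]; simp
        · rw [Set.indicator_of_notMem hx]; simp)
      (fun x => by
        by_cases hx : x ∈ ⋃ i, S i
        · obtain ⟨i, hi⟩ := Set.mem_iUnion.1 hx
          rw [Set.indicator_of_mem hx]
          refine tendsto_const_nhds.congr' ?_
          filter_upwards [eventually_gt_atTop i] with n hn
          rw [Set.indicator_of_mem]
          exact Set.mem_biUnion (Finset.mem_range.2 hn) hi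
        · rw [Set.indicator_of_notMem hx]
          refine tendsto_const_nhds.congr fun n => ?_
          rw [Set.indicator_of_notMem]
          intro hx'
          obtain ⟨i, _, hi⟩ := Set.mem_iUnion₂.1 hx'
          exact hx (Set.mem_iUnion.2 ⟨i, hi⟩)) ψ
    have hre := (Complex.continuous_re.tendsto _).comp
      ((tendsto_const_nhds (x := ψ)).inner (𝕜 := ℂ) hlim)
    refine hre.congr fun n => ?_
    simp only [Function.comp_apply]
    rw [← hfin, sum_apply, inner_sum, Complex.re_sum]
  · simp

/-- The spectral measure `μ_ψ(S) = ⟨ψ, P_S ψ⟩` of the vector `ψ`. -/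
def spectralMeasure (A : 𝓗 →ₗ.[ℂ] 𝓗) (ψ : 𝓗) : Measure ℝ :=
  Measure.ofMeasurable
    (fun S _ => ENNReal.ofReal (inner ℂ ψ (spectralProjection A S ψ)).re)
    (by
      have h := hasSum_inner_spectralProjection A ψ (fun _ => ∅) (fun _ => MeasurableSet.empty)
        (fun i j _ => by simp [Function.onFun])
      have h0 : (inner ℂ ψ (spectralProjection A ∅ ψ)).re = 0 := by
        simp only [Set.iUnion_empty, Finset.sum_const, Finset.card_range, nsmul_eq_mul] at h
        have h1 := (tendsto_add_atTop_iff_nat 1).2 h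
        have h2 := h1.sub h
        simp only [Nat.cast_add, Nat.cast_one, add_mul, one_mul, add_sub_cancel_left,
          sub_self] at h2
        exact tendsto_nhds_unique tendsto_const_nhds h2
      rw [h0, ENNReal.ofReal_zero])
    (fun S hS hd => by
      have hnn := fun i => inner_spectralProjection_nonneg A ψ (hS i)
      have h := hasSum_inner_spectralProjection A ψ S hS hd
      have hs := (hasSum_iff_tendsto_nat_of_nonneg hnn _).2 h
      rw [← hs.tsum_eq]
      exact ENNReal.ofReal_tsum_of_nonneg hnn hs.summable)

end Calculus

/-! ### Jacobi operators on the half-line -/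

/-- The Hilbert space `ℓ²(ℤ₊)`, with `ℤ₊ = {1, 2, 3, …}`. -/
abbrev HalfLine : Type := lp (fun _ : ℕ+ => ℂ) 2

/-- A function on `ℤ₊`, extended by `0` to the site `0` (the Dirichlet condition). -/
def zeroExtend (u : ℕ+ → ℂ) (n : ℕ) : ℂ := if h : 0 < n then u (n.toPNat h) else 0

/-- The difference expression `a(n) u(n+1) + a(n-1) u(n-1) + b(n) u(n)`, `n ≥ 1`, with `u(0) = 0`.
-/
def jacobiExpr (a b : ℕ → ℝ) (u : ℕ+ → ℂ) (n : ℕ+) : ℂ :=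
  a n * zeroExtend u (n + 1) + a (n - 1) * zeroExtend u (n - 1) + b n * zeroExtend u n

theorem jacobiExpr_add (a b : ℕ → ℝ) (u v : ℕ+ → ℂ) :
    jacobiExpr a b (u + v) = jacobiExpr a b u + jacobiExpr a b v := by
  funext n
  have h : ∀ k, zeroExtend (u + v) k = zeroExtend u k + zeroExtend v k := by
    intro k; unfold zeroExtend; split_ifs <;> simp
  simp only [jacobiExpr, h, Pi.add_apply]
  ring

theorem jacobiExpr_smul (a b : ℕ → ℝ) (c : ℂ) (u : ℕ+ → ℂ) :
    jacobiExpr a b (c • u) = c • jacobiExpr a b u := by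
  funext n
  have h : ∀ k, zeroExtend (c • u) k = c * zeroExtend u k := by
    intro k; unfold zeroExtend; split_ifs <;> simp
  simp only [jacobiExpr, h, Pi.smul_apply, smul_eq_mul]
  ring

/-- The half-line Jacobi operator `H₊` with Dirichlet boundary condition, on its maximal domain
`{u ∈ ℓ² : Hu ∈ ℓ²}`. -/
def jacobiOperator (a b : ℕ → ℝ) : HalfLine →ₗ.[ℂ] HalfLine where
  domain :=
    { carrier := {u | Memℓp (jacobiExpr a b (u : ℕ+ → ℂ)) 2}
      add_mem' := fun {u v} hu hv => by
        simp only [Set.mem_ofPred_eq, lp.coeFn_add, jacobiExpr_add] at *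
        exact hu.add hv
      zero_mem' := by
        have h : jacobiExpr a b (0 : ℕ+ → ℂ) = 0 := by
          have := jacobiExpr_smul a b 0 0
          simpa using this
        simp only [Set.mem_ofPred_eq, lp.coeFn_zero, h]
        exact zero_memℓp
      smul_mem' := fun c u hu => by
        simp only [Set.mem_ofPred_eq, lp.coeFn_smul, jacobiExpr_smul] at *
        exact hu.const_smul c }
  toFun :=
    { toFun := fun u => ⟨jacobiExpr a b ((u : HalfLine) : ℕ+ → ℂ), u.2⟩
      map_add' := fun u v => by
        apply Subtype.ext
        exact jacobiExpr_add a b _ _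
      map_smul' := fun c u => by
        apply Subtype.ext
        exact jacobiExpr_smul a b c _ }

/-- The unit vector `δ₁`. -/
def deltaOne : HalfLine := lp.single 2 (1 : ℕ+) (1 : ℂ)

/-- The solution `u_θ(·, E)` of `a(n) u(n+1) + a(n-1) u(n-1) + b(n) u(n) = E u(n)`, `n ≥ 1`, with
`u_θ(0, E) = sin θ` and `u_θ(1, E) = cos θ`, at a real energy `E`. -/
def solution (a b : ℕ → ℝ) (θ E : ℝ) : ℕ → ℝ
  | 0 => Real.sin θ
  | 1 => Real.cos θ
  | n + 2 => ((E - b (n + 1)) * solution a b θ E (n + 1) - a n * solution a b θ E n) / a (n + 1)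

/-- `‖φ‖²_L = ∑_{n=1}^{⌊L⌋} |φ(n)|² + (L - ⌊L⌋) |φ(⌊L⌋+1)|²`, for `L ≥ 0`; the value `φ(0)` plays
no role. -/
def normSqUpTo {F : Type*} [NormedAddCommGroup F] (φ : ℕ → F) (L : ℝ) : ℝ :=
  ∑ n ∈ Finset.Icc 1 ⌊L⌋₊, ‖φ n‖ ^ 2 + (L - ⌊L⌋₊) * ‖φ (⌊L⌋₊ + 1)‖ ^ 2

/-- `‖φ‖_L`. -/
def normUpTo {F : Type*} [NormedAddCommGroup F] (φ : ℕ → F) (L : ℝ) : ℝ :=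
  √(normSqUpTo φ L)

/-- `max_θ ‖u_θ(·, E)‖_L · min_θ ‖u_θ(·, E)‖_L`; both extrema are attained, since the norm is
continuous and periodic in `θ`. -/
def scaleProduct (a b : ℕ → ℝ) (E L : ℝ) : ℝ :=
  (⨆ θ : ℝ, normUpTo (solution a b θ E) L) * (⨅ θ : ℝ, normUpTo (solution a b θ E) L)

/-- The characteristic length scale `L⁺_ε(E)`: the solution `L` of
`max_θ ‖u_θ(·, E)‖_L · min_θ ‖u_θ(·, E)‖_L = ε⁻¹`, which is unique when `a` never vanishes and
`∑ |a(n)|⁻¹` diverges (the set below then has exactly one element). -/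
def lengthScale (a b : ℕ → ℝ) (ε E : ℝ) : ℝ :=
  sInf {L : ℝ | 0 ≤ L ∧ scaleProduct a b E L = ε⁻¹}

/-- The time average `⟨A(t)⟩_T = (2 / T) ∫₀^∞ e^{-2t/T} A(t) dt` of a nonnegative quantity. -/
def timeAverage (A : ℝ → ℝ) (T : ℝ) : ℝ≥0∞ :=
  ENNReal.ofReal (2 / T) * ∫⁻ t in Set.Ioi (0 : ℝ), ENNReal.ofReal (Real.exp (-2 * t / T) * A t)

end JacobiDynamics

end

/-! Put `ε = 2/T`. For bounded `S` the packet at site `n` is the Fourier transform of `1_S u_0(n,·)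
μ` (`zeroExtend_evolution_eq_integral`). Averaging its squared modulus against `ε e^{-εt}`, with the
`t`-integral done first, gives the quadratic form of the kernel `ε²/((x-y)²+ε²)`. A Schur test
bounds this form by `∫ f² ε² P dμ`, with `P(E) = ∫ ((x-E)²+ε²)⁻¹ dμ(x)`
(`lintegral_exp_mul_norm_integral_sq_le`). Summing over sites leaves a pointwise claim: `ε² P(E)
‖u_0‖² ≤ 9` at the length `L⁺_{1/T}(E)`. Unbounded `S` follows by truncation and Fatou.

For the pointwise claim take `φ = (H - E - iε)⁻¹ δ_1`, continued by `φ(0) = -1`. Then `Im φ(1) = εP`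
and `‖φ‖² = P`. Variation of constants writes `φ` as `φ(1) u_0 + φ(0) u_{π/2}` plus `iε` times a
triangular kernel applied to `φ`. The Hilbert-Schmidt norm of that kernel on the window `L` is the
root of the Gram determinant of `u_0, u_{π/2}`, which is the product of the maximum and the minimum
of `‖u_θ‖_L` (`gramDet_eq_sum`, `scaleProduct_eq_sqrt`). Imaginary parts remove the `u_{π/2}` term,
so `εP ‖u_0‖_L ≤ (1 + ε·max·min) √P` (`im_sq_mul_normSqUpTo_le`,
`sq_mul_poisson_mul_normSqUpTo_le`). At the length scale the product is `T`, so the bracket is `1 +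
2 = 3` and its square is the constant 9.

The operators `f(H)` come from a chosen functional calculus, so one must be shown to exist. Gaussian
quadrature for truncated matrices and a weak limit give a measure that makes the `u_0(n,·)`, `n ≥
1`, orthonormal (`exists_orthogonality_measure`). Divergence of `∑ |a(n)|⁻¹` rules out nonzero `ℓ²`
solutions at nonreal energies (`eq_zero_of_summable_norm_sq`). This is used twice: it makes these
polynomials complete in `L²`, and it identifies `H` on its maximal domain with multiplication by
`x`. -/

namespace JacobiDynamics

/-! ### The truncated norm as a weighted sum -/

/-- The weight with which the site `n ≥ 1` enters `‖·‖_L²`. -/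
noncomputable def siteWeight (L : ℝ) (n : ℕ) : ℝ := max 0 (min 1 (L - n + 1))

theorem siteWeight_nonneg (L : ℝ) (n : ℕ) : 0 ≤ siteWeight L n := le_max_left _ _

theorem siteWeight_le_one (L : ℝ) (n : ℕ) : siteWeight L n ≤ 1 :=
  max_le zero_le_one (min_le_left _ _)

theorem continuous_siteWeight (n : ℕ) : Continuous fun L => siteWeight L n := by
  unfold siteWeight; fun_prop

theorem siteWeight_eq_one {L : ℝ} {n : ℕ} (h : (n : ℝ) ≤ L) : siteWeight L n = 1 := by
  rw [siteWeight, min_eq_left (by linarith), max_eq_right zero_le_one]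

theorem siteWeight_eq_zero {L : ℝ} {n : ℕ} (h : L + 1 ≤ n) : siteWeight L n = 0 := by
  rw [siteWeight, max_eq_left]
  exact (min_le_right _ _).trans (by linarith)

/-- Only the last site of the window can carry a fractional weight. This lets weights be inserted
for free in strictly triangular sums. -/
theorem siteWeight_eq_one_of_lt {L : ℝ} {m n : ℕ} (hmn : m < n) (h : siteWeight L n ≠ 0) :
    siteWeight L m = 1 := by
  apply siteWeight_eq_one
  by_contra! hm
  apply h
  apply siteWeight_eq_zero
  have : (m : ℝ) + 1 ≤ n := by exact_mod_cast hmn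
  linarith

theorem sum_siteWeight_eq (f : ℕ → ℝ) {L : ℝ} {M N : ℕ} (hM : L ≤ M) (hMN : M ≤ N) :
    ∑ n ∈ Finset.Icc 1 M, siteWeight L n * f n = ∑ n ∈ Finset.Icc 1 N, siteWeight L n * f n := by
  apply Finset.sum_subset (Finset.Icc_subset_Icc_right hMN)
  intro n hn hn'
  simp only [Finset.mem_Icc] at hn hn'
  have : (M : ℝ) + 1 ≤ n := by exact_mod_cast (by omega : M + 1 ≤ n)
  rw [siteWeight_eq_zero (by linarith), zero_mul]

/-- Any `N ≥ L` is allowed, so the index set need not move with `L`; continuity in `L` is then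
visible from the weights. -/
theorem normSqUpTo_eq_sum {F : Type*} [NormedAddCommGroup F] (φ : ℕ → F) {L : ℝ} {N : ℕ}
    (hL : 0 ≤ L) (hN : L ≤ N) :
    normSqUpTo φ L = ∑ n ∈ Finset.Icc 1 N, siteWeight L n * ‖φ n‖ ^ 2 := by
  have hfl : (⌊L⌋₊ : ℝ) ≤ L := Nat.floor_le hL
  have hlt : L < ⌊L⌋₊ + 1 := Nat.lt_floor_add_one L
  have h1 : normSqUpTo φ L =
      ∑ n ∈ Finset.Icc 1 (⌊L⌋₊ + 1), siteWeight L n * ‖φ n‖ ^ 2 := by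
    rw [Finset.sum_Icc_succ_top (by omega), normSqUpTo]
    congr 1
    · refine Finset.sum_congr rfl fun n hn => ?_
      have : (n : ℝ) ≤ ⌊L⌋₊ := by exact_mod_cast (Finset.mem_Icc.1 hn).2
      rw [siteWeight_eq_one (by linarith), one_mul]
    · rw [siteWeight, min_eq_right (by push_cast; linarith), max_eq_right (by push_cast; linarith)]
      push_cast
      ring
  rw [h1, sum_siteWeight_eq (fun n => ‖φ n‖ ^ 2) (M := ⌊L⌋₊ + 1) (N := max N (⌊L⌋₊ + 1))
    (by push_cast; linarith) (le_max_right _ _),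
    ← sum_siteWeight_eq (fun n => ‖φ n‖ ^ 2) hN (le_max_left _ _)]

theorem normSqUpTo_nonneg {F : Type*} [NormedAddCommGroup F] (φ : ℕ → F) {L : ℝ} (hL : 0 ≤ L) :
    0 ≤ normSqUpTo φ L := by
  rw [normSqUpTo_eq_sum φ hL (Nat.le_ceil L)]
  exact Finset.sum_nonneg fun n _ => mul_nonneg (siteWeight_nonneg _ _) (sq_nonneg _)

/-! ### Extrema of a binary quadratic form on the unit circle -/

/-- By double angles the form is `(A+B)/2 + R cos(2θ - φ)`, so its extrema are the eigenvalues
`(A+B)/2 ± R`, whose product is the determinant. Positivity of the form is not needed: a negative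
smaller eigenvalue gives root zero on both sides. -/
theorem iSup_mul_iInf_sqrt_quadratic {A B D : ℝ} (hA : 0 ≤ A) (hB : 0 ≤ B) :
    (⨆ θ : ℝ, √(A * Real.cos θ ^ 2 + 2 * D * (Real.cos θ * Real.sin θ) + B * Real.sin θ ^ 2)) *
      (⨅ θ : ℝ, √(A * Real.cos θ ^ 2 + 2 * D * (Real.cos θ * Real.sin θ) + B * Real.sin θ ^ 2))
      = √(A * B - D ^ 2) := by
  set w : ℂ := ⟨(A - B) / 2, D⟩
  set R := ‖w‖
  set φ := w.arg
  have hc : R * Real.cos φ = (A - B) / 2 := Complex.norm_mul_cos_arg w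
  have hs : R * Real.sin φ = D := Complex.norm_mul_sin_arg w
  have hR0 : 0 ≤ R := norm_nonneg _
  have hR2 : R ^ 2 = ((A - B) / 2) ^ 2 + D ^ 2 := by
    rw [← hc, ← hs]
    linear_combination (-R ^ 2) * Real.sin_sq_add_cos_sq φ
  have hq : ∀ θ, A * Real.cos θ ^ 2 + 2 * D * (Real.cos θ * Real.sin θ) + B * Real.sin θ ^ 2
      = (A + B) / 2 + R * Real.cos (2 * θ - φ) := by
    intro θ
    rw [Real.cos_sub, Real.cos_two_mul, Real.sin_two_mul]
    linear_combination (1 - 2 * Real.cos θ ^ 2) * hc - 2 * Real.sin θ * Real.cos θ * hs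
      + B * Real.sin_sq_add_cos_sq θ
  simp only [hq]
  have hsup : (⨆ θ : ℝ, √((A + B) / 2 + R * Real.cos (2 * θ - φ))) = √((A + B) / 2 + R) := by
    have hle : ∀ θ : ℝ, √((A + B) / 2 + R * Real.cos (2 * θ - φ)) ≤ √((A + B) / 2 + R) :=
      fun θ => Real.sqrt_le_sqrt (by nlinarith [Real.cos_le_one (2 * θ - φ)])
    refine le_antisymm (ciSup_le hle) ?_
    refine le_ciSup_of_le ⟨_, Set.forall_mem_range.2 hle⟩ (φ / 2) ?_
    rw [mul_div_cancel₀ _ two_ne_zero, sub_self, Real.cos_zero, mul_one]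
  have hinf : (⨅ θ : ℝ, √((A + B) / 2 + R * Real.cos (2 * θ - φ))) = √((A + B) / 2 - R) := by
    have hle : ∀ θ : ℝ, √((A + B) / 2 - R) ≤ √((A + B) / 2 + R * Real.cos (2 * θ - φ)) :=
      fun θ => Real.sqrt_le_sqrt (by nlinarith [Real.neg_one_le_cos (2 * θ - φ)])
    refine le_antisymm ?_ (le_ciInf hle)
    refine ciInf_le_of_le ⟨_, Set.forall_mem_range.2 hle⟩ ((φ + Real.pi) / 2) ?_
    rw [mul_div_cancel₀ _ two_ne_zero, add_sub_cancel_left, Real.cos_pi, mul_neg_one,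
      ← sub_eq_add_neg]
  rw [hsup, hinf, ← Real.sqrt_mul (by positivity)]
  congr 1
  linear_combination -hR2

/-- Lagrange's identity with weights, summed over the pairs `m < n` only. -/
theorem sum_lt_sq_eq (s : Finset ℕ) (c u v : ℕ → ℝ) :
    ∑ n ∈ s, c n * ∑ m ∈ s with m < n, c m * (u n * v m - v n * u m) ^ 2
      = (∑ n ∈ s, c n * u n ^ 2) * (∑ n ∈ s, c n * v n ^ 2)
        - (∑ n ∈ s, c n * (u n * v n)) ^ 2 := by
  have hsw : ∑ n ∈ s, c n * ∑ m ∈ s with m < n, c m * (u n * v m - v n * u m) ^ 2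
      = ∑ n ∈ s, c n * ∑ m ∈ s with n < m, c m * (u n * v m - v n * u m) ^ 2 := by
    simp only [Finset.mul_sum, Finset.sum_filter]
    rw [Finset.sum_comm]
    refine Finset.sum_congr rfl fun n _ => Finset.sum_congr rfl fun m _ => ?_
    split_ifs <;> ring
  have hfull : ∑ n ∈ s, c n * ∑ m ∈ s, c m * (u n * v m - v n * u m) ^ 2
      = (∑ n ∈ s, c n * ∑ m ∈ s with m < n, c m * (u n * v m - v n * u m) ^ 2)
        + ∑ n ∈ s, c n * ∑ m ∈ s with n < m, c m * (u n * v m - v n * u m) ^ 2 := by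
    simp only [Finset.sum_filter]
    rw [← Finset.sum_add_distrib]
    refine Finset.sum_congr rfl fun n _ => ?_
    rw [← mul_add, ← Finset.sum_add_distrib]
    congr 1
    refine Finset.sum_congr rfl fun m _ => ?_
    rcases lt_trichotomy m n with h | h | h
    · simp [h, h.not_gt]
    · subst h; simp; right; ring
    · simp [h, h.not_gt]
  have hexp : ∑ n ∈ s, c n * ∑ m ∈ s, c m * (u n * v m - v n * u m) ^ 2
      = 2 * ((∑ n ∈ s, c n * u n ^ 2) * (∑ n ∈ s, c n * v n ^ 2)
        - (∑ n ∈ s, c n * (u n * v n)) ^ 2) := by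
    have : ∀ n, c n * ∑ m ∈ s, c m * (u n * v m - v n * u m) ^ 2
        = (c n * u n ^ 2) * (∑ m ∈ s, c m * v m ^ 2)
          + (c n * v n ^ 2) * (∑ m ∈ s, c m * u m ^ 2)
          - 2 * (c n * (u n * v n)) * (∑ m ∈ s, c m * (u m * v m)) := by
      intro n
      simp only [Finset.mul_sum]
      rw [← Finset.sum_add_distrib, ← Finset.sum_sub_distrib]
      refine Finset.sum_congr rfl fun m _ => ?_
      ring
    simp only [this]
    rw [Finset.sum_sub_distrib, Finset.sum_add_distrib, ← Finset.sum_mul, ← Finset.sum_mul,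
      ← Finset.sum_mul, ← Finset.mul_sum]
    ring
  linarith

/-! ### Solutions at a real energy -/

theorem solution_add_two (a b : ℕ → ℝ) (ha : ∀ n, a n ≠ 0) (θ E : ℝ) (n : ℕ) :
    a (n + 1) * solution a b θ E (n + 2)
      = (E - b (n + 1)) * solution a b θ E (n + 1) - a n * solution a b θ E n := by
  rw [solution, mul_div_cancel₀ _ (ha _)]

theorem solution_eq_combination (a b : ℕ → ℝ) (θ E : ℝ) (n : ℕ) :
    solution a b θ E n = Real.cos θ * solution a b 0 E n
      + Real.sin θ * solution a b (Real.pi / 2) E n := by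
  induction n using Nat.twoStepInduction with
  | zero => simp [solution]
  | one => simp [solution]
  | more n h0 h1 => simp only [solution]; rw [h0, h1]; ring

/-- The Wronskian is constant in `n`, and `a 0 = 1` normalizes it at `n = 0`. The phase `θ` is kept
free for the lower bound on the scale product; `θ = 0` serves variation of constants. -/
theorem wronskian_solution (a b : ℕ → ℝ) (ha : ∀ n, a n ≠ 0) (ha0 : a 0 = 1) (E θ : ℝ) (n : ℕ) :
    a n * (solution a b θ E (n + 1) * solution a b (θ + Real.pi / 2) E n
      - solution a b (θ + Real.pi / 2) E (n + 1) * solution a b θ E n) = 1 := by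
  induction n with
  | zero =>
    simp only [solution, ha0, Real.cos_add_pi_div_two, Real.sin_add_pi_div_two]
    linear_combination Real.sin_sq_add_cos_sq θ
  | succ n ih =>
    linear_combination ih
      + solution a b (θ + Real.pi / 2) E (n + 1) * solution_add_two a b ha θ E n
      - solution a b θ E (n + 1) * solution_add_two a b ha (θ + Real.pi / 2) E n

theorem normSqUpTo_solution (a b : ℕ → ℝ) (θ E : ℝ) {L : ℝ} {N : ℕ} (hL : 0 ≤ L) (hN : L ≤ N) :
    normSqUpTo (solution a b θ E) L
      = (∑ n ∈ Finset.Icc 1 N, siteWeight L n * solution a b 0 E n ^ 2) * Real.cos θ ^ 2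
        + 2 * (∑ n ∈ Finset.Icc 1 N,
            siteWeight L n * (solution a b 0 E n * solution a b (Real.pi / 2) E n))
          * (Real.cos θ * Real.sin θ)
        + (∑ n ∈ Finset.Icc 1 N, siteWeight L n * solution a b (Real.pi / 2) E n ^ 2)
          * Real.sin θ ^ 2 := by
  rw [normSqUpTo_eq_sum _ hL hN]
  simp only [Finset.sum_mul, Finset.mul_sum]
  rw [← Finset.sum_add_distrib, ← Finset.sum_add_distrib]
  refine Finset.sum_congr rfl fun n _ => ?_
  rw [Real.norm_eq_abs, sq_abs, solution_eq_combination a b θ]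
  ring

/-- The Gram determinant of `u_0` and `u_{π/2}` on the first `N` sites, with weights for `L`. -/
noncomputable def gramDet (a b : ℕ → ℝ) (E : ℝ) (N : ℕ) (L : ℝ) : ℝ :=
  (∑ n ∈ Finset.Icc 1 N, siteWeight L n * solution a b 0 E n ^ 2)
    * (∑ n ∈ Finset.Icc 1 N, siteWeight L n * solution a b (Real.pi / 2) E n ^ 2)
    - (∑ n ∈ Finset.Icc 1 N,
        siteWeight L n * (solution a b 0 E n * solution a b (Real.pi / 2) E n)) ^ 2

/-- The right side is the squared weighted Hilbert-Schmidt norm of the variation-of-constants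
kernel; this is why the product of maximum and minimum is the natural length gauge. -/
theorem gramDet_eq_sum (a b : ℕ → ℝ) (E : ℝ) (N : ℕ) (L : ℝ) :
    gramDet a b E N L = ∑ n ∈ Finset.Icc 1 N, siteWeight L n *
      ∑ m ∈ Finset.Icc 1 N with m < n, siteWeight L m *
        (solution a b 0 E n * solution a b (Real.pi / 2) E m
          - solution a b (Real.pi / 2) E n * solution a b 0 E m) ^ 2 :=
  (sum_lt_sq_eq _ _ _ _).symm

theorem gramDet_nonneg (a b : ℕ → ℝ) (E : ℝ) (N : ℕ) (L : ℝ) : 0 ≤ gramDet a b E N L := by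
  rw [gramDet_eq_sum]
  exact Finset.sum_nonneg fun n _ => mul_nonneg (siteWeight_nonneg _ _) <|
    Finset.sum_nonneg fun m _ => mul_nonneg (siteWeight_nonneg _ _) (sq_nonneg _)

theorem continuous_gramDet (a b : ℕ → ℝ) (E : ℝ) (N : ℕ) : Continuous (gramDet a b E N) := by
  have := continuous_siteWeight
  unfold gramDet
  fun_prop

theorem scaleProduct_eq_sqrt (a b : ℕ → ℝ) (E : ℝ) {L : ℝ} {N : ℕ} (hL : 0 ≤ L) (hN : L ≤ N) :
    scaleProduct a b E L = √(gramDet a b E N L) := by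
  unfold scaleProduct normUpTo
  simp only [normSqUpTo_solution a b _ E hL hN]
  refine iSup_mul_iInf_sqrt_quadratic ?_ ?_
  all_goals exact Finset.sum_nonneg fun n _ => mul_nonneg (siteWeight_nonneg _ _) (sq_nonneg _)

theorem bddAbove_range_normUpTo (a b : ℕ → ℝ) (E : ℝ) {L : ℝ} (hL : 0 ≤ L) :
    BddAbove (Set.range fun θ => normUpTo (solution a b θ E) L) := by
  have hc : Continuous fun θ => normUpTo (solution a b θ E) L := by
    unfold normUpTo
    simp only [normSqUpTo_solution a b _ E hL (Nat.le_ceil L)]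
    fun_prop
  refine (Function.Periodic.compact_of_continuous (c := 2 * Real.pi) ?_ ?_ hc).bddAbove
  · intro θ
    simp only
    congr 1
    funext n
    rw [solution_eq_combination a b (θ + 2 * Real.pi), solution_eq_combination a b θ,
      Real.cos_add_two_pi, Real.sin_add_two_pi]
  · positivity

/-- The Wronskian writes `1/a(n)` through `u_θ` and `u_{θ+π/2}` at adjacent sites, and
Cauchy-Schwarz sums it. Hence the scale product is unbounded when `∑ |a(n)|⁻¹` diverges, and every
value `ε⁻¹` is reached. -/
theorem sum_inv_le_scaleProduct (a b : ℕ → ℝ) (ha : ∀ n, a n ≠ 0) (ha0 : a 0 = 1) (E : ℝ)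
    (N : ℕ) : (∑ n ∈ Finset.Icc 1 N, |a n|⁻¹) ≤ 2 * scaleProduct a b E (N + 1) := by
  have hN : (0 : ℝ) ≤ N + 1 := by positivity
  have hpt : ∀ θ, (∑ n ∈ Finset.Icc 1 N, |a n|⁻¹) ≤
      2 * (normUpTo (solution a b (θ + Real.pi / 2) E) (N + 1)
        * normUpTo (solution a b θ E) (N + 1)) := by
    intro θ
    set f := solution a b θ E
    set g := solution a b (θ + Real.pi / 2) E
    have hnorm : ∀ h : ℕ → ℝ, normUpTo h (N + 1) = √(∑ n ∈ Finset.Icc 1 (N + 1), |h n| ^ 2) := by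
      intro h
      have hfl : ⌊(N : ℝ) + 1⌋₊ = N + 1 := by exact_mod_cast Nat.floor_natCast (R := ℝ) (N + 1)
      simp [normUpTo, normSqUpTo, hfl]
    have hshift : ∀ h : ℕ → ℝ, √(∑ n ∈ Finset.Icc 1 N, |h (n + 1)| ^ 2) ≤ normUpTo h (N + 1) := by
      intro h
      rw [hnorm]
      apply Real.sqrt_le_sqrt
      have : ∑ n ∈ Finset.Icc 1 N, |h (n + 1)| ^ 2 = ∑ n ∈ Finset.Icc 2 (N + 1), |h n| ^ 2 := by
        rw [show (2 : ℕ) = 1 + 1 from rfl, ← Finset.map_add_right_Icc 1 N 1, Finset.sum_map]; rfl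
      rw [this]
      exact Finset.sum_le_sum_of_subset_of_nonneg (Finset.Icc_subset_Icc_left (by norm_num))
        fun _ _ _ => by positivity
    have hplain : ∀ h : ℕ → ℝ, √(∑ n ∈ Finset.Icc 1 N, |h n| ^ 2) ≤ normUpTo h (N + 1) := by
      intro h
      rw [hnorm]
      apply Real.sqrt_le_sqrt
      exact Finset.sum_le_sum_of_subset_of_nonneg (Finset.Icc_subset_Icc_right (by omega))
        fun _ _ _ => by positivity
    have hterm : ∀ n, |a n|⁻¹ ≤ |f (n + 1)| * |g n| + |g (n + 1)| * |f n| := by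
      intro n
      have hW := wronskian_solution a b ha ha0 E θ n
      have : (a n)⁻¹ = f (n + 1) * g n - g (n + 1) * f n := by
        rw [inv_eq_iff_eq_inv, ← one_div, ← hW]
        rw [eq_div_iff]
        intro h0
        rw [show solution a b θ E (n + 1) * solution a b (θ + Real.pi / 2) E n
          - solution a b (θ + Real.pi / 2) E (n + 1) * solution a b θ E n = 0 from h0] at hW
        simp at hW
      rw [← abs_inv, this, ← abs_mul, ← abs_mul]
      exact abs_sub _ _
    calc ∑ n ∈ Finset.Icc 1 N, |a n|⁻¹
        ≤ ∑ n ∈ Finset.Icc 1 N, (|f (n + 1)| * |g n| + |g (n + 1)| * |f n|) :=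
          Finset.sum_le_sum fun n _ => hterm n
      _ = ∑ n ∈ Finset.Icc 1 N, |f (n + 1)| * |g n|
          + ∑ n ∈ Finset.Icc 1 N, |g (n + 1)| * |f n| := Finset.sum_add_distrib
      _ ≤ normUpTo f (N + 1) * normUpTo g (N + 1) + normUpTo g (N + 1) * normUpTo f (N + 1) := by
          refine add_le_add ?_ ?_
          all_goals
            refine (Real.sum_mul_le_sqrt_mul_sqrt _ _ _).trans ?_
            exact mul_le_mul (hshift _) (hplain _) (Real.sqrt_nonneg _) (Real.sqrt_nonneg _)
      _ = _ := by ring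
  unfold scaleProduct
  have hsup : 0 ≤ ⨆ θ : ℝ, normUpTo (solution a b θ E) (N + 1) :=
    Real.iSup_nonneg fun _ => Real.sqrt_nonneg _
  rw [Real.mul_iInf_of_nonneg hsup,
    Real.mul_iInf_of_nonneg zero_le_two]
  refine le_ciInf fun θ => (hpt θ).trans ?_
  -- The factor `u_{θ+π/2}` is absorbed into the supremum, while `u_θ` is left for the infimum.
  refine mul_le_mul_of_nonneg_left ?_ zero_le_two
  exact mul_le_mul_of_nonneg_right
    (le_ciSup (bddAbove_range_normUpTo a b E hN) (θ + Real.pi / 2)) (Real.sqrt_nonneg _)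

theorem scaleProduct_zero (a b : ℕ → ℝ) (E : ℝ) : scaleProduct a b E 0 = 0 := by
  simp [scaleProduct, normUpTo, normSqUpTo]

/-- The length scale solves its defining equation. -/
theorem lengthScale_spec (a b : ℕ → ℝ) (ha : ∀ n, a n ≠ 0) (ha0 : a 0 = 1)
    (hsum : ¬ Summable fun n => |a n|⁻¹) {ε : ℝ} (hε : 0 < ε) (E : ℝ) :
    0 ≤ lengthScale a b ε E ∧ scaleProduct a b E (lengthScale a b ε E) = ε⁻¹ := by
  obtain ⟨N, hN⟩ : ∃ N : ℕ, ε⁻¹ ≤ scaleProduct a b E (N + 1) := by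
    have ht := (not_summable_iff_tendsto_nat_atTop_of_nonneg
      (fun n => inv_nonneg.2 (abs_nonneg (a n)))).1 hsum
    obtain ⟨M, hM⟩ := (ht.eventually_ge_atTop (2 * ε⁻¹ + 1)).exists
    refine ⟨M, ?_⟩
    have h1 := sum_inv_le_scaleProduct a b ha ha0 E M
    have h2 : ∑ n ∈ Finset.range M, |a n|⁻¹ ≤ 1 + ∑ n ∈ Finset.Icc 1 M, |a n|⁻¹ := by
      have : ∑ n ∈ Finset.range (M + 1), |a n|⁻¹ = 1 + ∑ n ∈ Finset.Icc 1 M, |a n|⁻¹ := by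
        rw [Finset.sum_range_eq_add_Ico _ (by omega), ha0]
        simp [Finset.Ico_add_one_right_eq_Icc]
      rw [← this]
      exact Finset.sum_le_sum_of_subset_of_nonneg (Finset.range_mono (by omega))
        fun _ _ _ => by positivity
    linarith
  have hN0 : (0 : ℝ) ≤ ((N + 1 : ℕ) : ℝ) := by positivity
  have hcont : ContinuousOn (scaleProduct a b E) (Set.Icc 0 ((N + 1 : ℕ) : ℝ)) :=
    (continuous_gramDet a b E (N + 1)).sqrt.continuousOn.congr
      fun L hL => scaleProduct_eq_sqrt a b E hL.1 hL.2
  have hne : (Set.Icc 0 ((N + 1 : ℕ) : ℝ) ∩ scaleProduct a b E ⁻¹' {ε⁻¹}).Nonempty := by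
    obtain ⟨L, hL, hLe⟩ := intermediate_value_Icc hN0 hcont
      (show ε⁻¹ ∈ Set.Icc _ _ from ⟨by rw [scaleProduct_zero]; positivity, by exact_mod_cast hN⟩)
    exact ⟨L, hL, hLe⟩
  have hcpt : IsCompact (Set.Icc 0 ((N + 1 : ℕ) : ℝ) ∩ scaleProduct a b E ⁻¹' {ε⁻¹}) :=
    isCompact_Icc.of_isClosed_subset
      (hcont.preimage_isClosed_of_isClosed isClosed_Icc isClosed_singleton) Set.inter_subset_left
  -- The infimum defining the length scale is attained, by compactness of the solution set on `[0,
  -- N+1]`; uniqueness of the solution plays no role.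
  obtain ⟨L, hL, hmin⟩ := hcpt.exists_isLeast hne
  have hleast : IsLeast {L : ℝ | 0 ≤ L ∧ scaleProduct a b E L = ε⁻¹} L := by
    refine ⟨⟨hL.1.1, hL.2⟩, fun L' hL' => ?_⟩
    rcases le_total L' ((N + 1 : ℕ) : ℝ) with h | h
    · exact hmin ⟨⟨hL'.1, h⟩, hL'.2⟩
    · exact hL.1.2.trans h
  rw [lengthScale, hleast.csInf_eq]
  exact hleast.1

/-- If `u_0` vanished on the window, the minimum over `θ` would be zero, and so would the product
`ε⁻¹`. -/
theorem normSqUpTo_lengthScale_pos (a b : ℕ → ℝ) (ha : ∀ n, a n ≠ 0) (ha0 : a 0 = 1)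
    (hsum : ¬ Summable fun n => |a n|⁻¹) {ε : ℝ} (hε : 0 < ε) (E : ℝ) :
    0 < normSqUpTo (solution a b 0 E) (lengthScale a b ε E) := by
  obtain ⟨h0, h1⟩ := lengthScale_spec a b ha ha0 hsum hε E
  refine lt_of_le_of_ne (normSqUpTo_nonneg _ h0) fun h => ?_
  have hinf : (⨅ θ : ℝ, normUpTo (solution a b θ E) (lengthScale a b ε E)) = 0 := by
    refine le_antisymm ?_ (Real.iInf_nonneg fun _ => Real.sqrt_nonneg _)
    refine ciInf_le_of_le ⟨0, Set.forall_mem_range.2 fun _ => Real.sqrt_nonneg _⟩ 0 ?_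
    rw [normUpTo, ← h, Real.sqrt_zero]
  rw [scaleProduct, hinf, mul_zero] at h1
  exact (inv_pos.2 hε).ne h1

/-! ### Comparison with solutions at a complex energy -/

/-- Variation of constants. -/
theorem eq_combination_of_complex_energy (a b : ℕ → ℝ) (ha : ∀ n, a n ≠ 0) (ha0 : a 0 = 1)
    (E : ℝ) (ζ : ℂ) (φ : ℕ → ℂ)
    (hφ : ∀ n, a (n + 1) * φ (n + 2) + a n * φ n + b (n + 1) * φ (n + 1)
      = (E + ζ) * φ (n + 1)) (n : ℕ) :
    φ (n + 1) = φ 1 * solution a b 0 E (n + 1) + φ 0 * solution a b (Real.pi / 2) E (n + 1)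
      + ζ * ∑ m ∈ Finset.Icc 1 n, ((solution a b 0 E (n + 1) * solution a b (Real.pi / 2) E m
          - solution a b (Real.pi / 2) E (n + 1) * solution a b 0 E m : ℝ) : ℂ) * φ m := by
  set u := solution a b 0 E with hu
  set v := solution a b (Real.pi / 2) E with hv
  have hW : ∀ n, (a n : ℂ) * (u (n + 1) * v n - v (n + 1) * u n) = 1 := by
    intro n
    have := wronskian_solution a b ha ha0 E 0 n
    rw [zero_add] at this
    exact_mod_cast this
  have hur : ∀ n, (a (n + 1) : ℂ) * u (n + 2) = (E - b (n + 1)) * u (n + 1) - a n * u n := by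
    intro n; exact_mod_cast solution_add_two a b ha 0 E n
  have hvr : ∀ n, (a (n + 1) : ℂ) * v (n + 2) = (E - b (n + 1)) * v (n + 1) - a n * v n := by
    intro n; exact_mod_cast solution_add_two a b ha (Real.pi / 2) E n
  have hsplit : ∀ n k, ∑ m ∈ Finset.Icc 1 n, ((u k * v m - v k * u m : ℝ) : ℂ) * φ m
      = u k * (∑ m ∈ Finset.Icc 1 n, v m * φ m) - v k * (∑ m ∈ Finset.Icc 1 n, u m * φ m) := by
    intro n k
    rw [Finset.mul_sum, Finset.mul_sum, ← Finset.sum_sub_distrib]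
    refine Finset.sum_congr rfl fun m _ => ?_
    push_cast; ring
  simp only [hsplit]
  -- The recurrence has order two, so the formula is carried at sites `n` and `n + 1` with the same
  -- sums up to `n`; advancing the sums at site `n + 1` costs nothing, since the kernel vanishes on
  -- the diagonal.
  suffices H : φ n = φ 1 * u n + φ 0 * v n + ζ * (u n * (∑ m ∈ Finset.Icc 1 n, v m * φ m)
        - v n * (∑ m ∈ Finset.Icc 1 n, u m * φ m)) ∧
      φ (n + 1) = φ 1 * u (n + 1) + φ 0 * v (n + 1)
        + ζ * (u (n + 1) * (∑ m ∈ Finset.Icc 1 n, v m * φ m)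
        - v (n + 1) * (∑ m ∈ Finset.Icc 1 n, u m * φ m)) from H.2
  induction n with
  | zero => simp [hu, hv, solution]
  | succ n ih =>
    obtain ⟨h0, h1⟩ := ih
    rw [Finset.sum_Icc_succ_top (by omega), Finset.sum_Icc_succ_top (by omega)]
    refine ⟨by linear_combination h1, ?_⟩
    have ha' : (a (n + 1) : ℂ) ≠ 0 := by exact_mod_cast ha (n + 1)
    apply mul_left_cancel₀ ha'
    rw [show n + 1 + 1 = n + 2 from rfl]
    set X := ∑ m ∈ Finset.Icc 1 n, (v m : ℂ) * φ m
    set Y := ∑ m ∈ Finset.Icc 1 n, (u m : ℂ) * φ m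
    linear_combination hφ n - a n * h0 + (E - b (n + 1)) * h1
      - (φ 1 + ζ * X) * hur n - (φ 0 - ζ * Y) * hvr n - ζ * φ (n + 1) * hW (n + 1)

/-- The Hilbert-Schmidt bound, by Cauchy-Schwarz in each row. In a row of nonzero weight all earlier
sites have weight one, so weights may be placed on both factors. -/
theorem weighted_triangular_bound (c : ℕ → ℝ) (s : Finset ℕ) (K : ℕ → ℕ → ℝ) (φ : ℕ → ℂ)
    (hc : ∀ n, 0 ≤ c n) (hc1 : ∀ m n, m < n → c n ≠ 0 → c m = 1) :
    ∑ n ∈ s, c n * ‖∑ m ∈ s with m < n, (K n m : ℂ) * φ m‖ ^ 2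
      ≤ (∑ n ∈ s, c n * ∑ m ∈ s with m < n, c m * K n m ^ 2) * ∑ m ∈ s, c m * ‖φ m‖ ^ 2 := by
  rw [Finset.sum_mul]
  refine Finset.sum_le_sum fun n _ => ?_
  rcases eq_or_ne (c n) 0 with h0 | h0
  · simp [h0]
  rw [mul_assoc]
  refine mul_le_mul_of_nonneg_left ?_ (hc n)
  calc ‖∑ m ∈ s with m < n, (K n m : ℂ) * φ m‖ ^ 2
      ≤ (∑ m ∈ s with m < n, |K n m| * ‖φ m‖) ^ 2 := by
        gcongr
        refine (norm_sum_le _ _).trans (le_of_eq ?_)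
        refine Finset.sum_congr rfl fun m _ => ?_
        rw [norm_mul, Complex.norm_real, Real.norm_eq_abs]
    _ ≤ (∑ m ∈ s with m < n, |K n m| ^ 2) * ∑ m ∈ s with m < n, ‖φ m‖ ^ 2 :=
        Finset.sum_mul_sq_le_sq_mul_sq _ _ _
    _ = (∑ m ∈ s with m < n, c m * K n m ^ 2) * ∑ m ∈ s with m < n, c m * ‖φ m‖ ^ 2 := by
        congr 1
        · refine Finset.sum_congr rfl fun m hm => ?_
          rw [hc1 m n (Finset.mem_filter.1 hm).2 h0, one_mul, sq_abs]
        · refine Finset.sum_congr rfl fun m hm => ?_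
          rw [hc1 m n (Finset.mem_filter.1 hm).2 h0, one_mul]
    _ ≤ _ := by
        refine mul_le_mul_of_nonneg_left ?_ (Finset.sum_nonneg fun m _ => mul_nonneg (hc m)
          (sq_nonneg _))
        exact Finset.sum_le_sum_of_subset_of_nonneg (Finset.filter_subset _ _)
          fun m _ _ => mul_nonneg (hc m) (sq_nonneg _)

/-- A solution at energy `E + ζ` controls the solution at energy `E` with the same data, up to the
scale on which `|ζ|` times the scale product is bounded. -/
theorem im_sq_mul_normSqUpTo_le (a b : ℕ → ℝ) (ha : ∀ n, a n ≠ 0) (ha0 : a 0 = 1)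
    (E : ℝ) (ζ : ℂ) (φ : ℕ → ℂ) (h0 : (φ 0).im = 0)
    (hφ : ∀ n, a (n + 1) * φ (n + 2) + a n * φ n + b (n + 1) * φ (n + 1)
      = (E + ζ) * φ (n + 1)) {L : ℝ} (hL : 0 ≤ L) :
    (φ 1).im ^ 2 * normSqUpTo (solution a b 0 E) L
      ≤ (1 + ‖ζ‖ * scaleProduct a b E L) ^ 2 * normSqUpTo φ L := by
  set N := ⌈L⌉₊
  have hN : L ≤ N := Nat.le_ceil L
  set s := Finset.Icc 1 N
  set c := siteWeight L
  set u := solution a b 0 E with hu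
  set v := solution a b (Real.pi / 2) E with hv
  set K : ℕ → ℕ → ℝ := fun n m => u n * v m - v n * u m
  set d : ℕ → ℂ := fun n => ∑ m ∈ s with m < n, (K n m : ℂ) * φ m
  have hc : ∀ n, 0 ≤ c n := siteWeight_nonneg L
  have hd : ∑ n ∈ s, c n * ‖d n‖ ^ 2 ≤ gramDet a b E N L * ∑ n ∈ s, c n * ‖φ n‖ ^ 2 := by
    rw [gramDet_eq_sum]
    exact weighted_triangular_bound c s K φ hc fun m n => siteWeight_eq_one_of_lt
  have heq : ∀ n ∈ s, φ 1 * u n + φ 0 * v n = φ n - ζ * d n := by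
    intro n hn
    obtain ⟨h1, h2⟩ := Finset.mem_Icc.1 hn
    obtain ⟨k, rfl⟩ : ∃ k, n = k + 1 := ⟨n - 1, by omega⟩
    have := eq_combination_of_complex_energy a b ha ha0 E ζ φ hφ k
    have hs : s.filter (· < k + 1) = Finset.Icc 1 k := by
      ext m; simp only [s, Finset.mem_filter, Finset.mem_Icc]; omega
    simp only [d, hs]
    linear_combination -this
  set g := √(gramDet a b E N L)
  have hg : scaleProduct a b E L = g := scaleProduct_eq_sqrt a b E hL hN
  have hg2 : g ^ 2 = gramDet a b E N L := Real.sq_sqrt (gramDet_nonneg a b E N L)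
  have hg0 : 0 ≤ g := Real.sqrt_nonneg _
  rw [hg, normSqUpTo_eq_sum _ hL hN, normSqUpTo_eq_sum _ hL hN]
  set P := ∑ n ∈ s, c n * ‖φ n‖ ^ 2 with hP
  have hP0 : 0 ≤ P := Finset.sum_nonneg fun n _ => mul_nonneg (hc n) (sq_nonneg _)
  rw [Finset.mul_sum]
  -- Both `u` and `v` are real and `φ 0` is real, so the imaginary part of `φ 1 * u + φ 0 * v` keeps
  -- only `u`.
  have hpt : ∀ n ∈ s, (φ 1).im ^ 2 * (c n * ‖u n‖ ^ 2) ≤ c n * (‖φ n‖ + ‖ζ‖ * ‖d n‖) ^ 2 := by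
    intro n hn
    have h1 : |(φ 1).im * u n| ≤ ‖φ n‖ + ‖ζ‖ * ‖d n‖ := by
      have : (φ 1).im * u n = (φ 1 * u n + φ 0 * v n).im := by
        simp [h0]
      rw [this, heq n hn]
      refine (Complex.abs_im_le_norm _).trans ((norm_sub_le _ _).trans ?_)
      rw [norm_mul]
    have h2 : ((φ 1).im * u n) ^ 2 ≤ (‖φ n‖ + ‖ζ‖ * ‖d n‖) ^ 2 := sq_le_sq' (abs_le.1 h1).1 (abs_le.1 h1).2
    rw [Real.norm_eq_abs, sq_abs]
    calc _ = c n * ((φ 1).im * u n) ^ 2 := by ring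
      _ ≤ _ := mul_le_mul_of_nonneg_left h2 (hc n)
  refine (Finset.sum_le_sum hpt).trans ?_
  -- This is the triangle inequality in weighted `ℓ²`, done by expanding the square and treating the
  -- cross term by Cauchy-Schwarz.
  have hexp : ∑ n ∈ s, c n * (‖φ n‖ + ‖ζ‖ * ‖d n‖) ^ 2
      = P + 2 * ‖ζ‖ * (∑ n ∈ s, c n * (‖φ n‖ * ‖d n‖)) + ‖ζ‖ ^ 2 * ∑ n ∈ s, c n * ‖d n‖ ^ 2 := by
    rw [hP, Finset.mul_sum, Finset.mul_sum, ← Finset.sum_add_distrib, ← Finset.sum_add_distrib]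
    exact Finset.sum_congr rfl fun n _ => by ring
  have hcs : ∑ n ∈ s, c n * (‖φ n‖ * ‖d n‖) ≤ g * P := by
    have h1 : (∑ n ∈ s, c n * (‖φ n‖ * ‖d n‖)) ^ 2 ≤ P * ∑ n ∈ s, c n * ‖d n‖ ^ 2 := by
      refine Finset.sum_sq_le_sum_mul_sum_of_sq_le_mul s
        (fun n _ => mul_nonneg (hc n) (sq_nonneg _)) (fun n _ => mul_nonneg (hc n) (sq_nonneg _))
        fun n _ => le_of_eq (by ring)
    refine le_of_sq_le_sq ?_ (by positivity)
    calc _ ≤ _ := h1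
      _ ≤ P * (gramDet a b E N L * P) := mul_le_mul_of_nonneg_left hd hP0
      _ = _ := by rw [← hg2]; ring
  rw [hexp]
  rw [← hg2] at hd
  nlinarith [mul_le_mul_of_nonneg_left hcs (mul_nonneg zero_le_two (norm_nonneg ζ)),
    mul_le_mul_of_nonneg_left hd (sq_nonneg ‖ζ‖)]

/-! ### Bounded Borel functions -/

theorem IsBoundedBorel.mul {f g : ℝ → ℂ} (hf : IsBoundedBorel f) (hg : IsBoundedBorel g) :
    IsBoundedBorel fun x => f x * g x := by
  obtain ⟨hfm, M, hM⟩ := hf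
  obtain ⟨hgm, M', hM'⟩ := hg
  refine ⟨hfm.mul hgm, M * M', fun x => ?_⟩
  rw [norm_mul]
  exact mul_le_mul (hM x) (hM' x) (norm_nonneg _) ((norm_nonneg _).trans (hM x))

theorem IsBoundedBorel.add {f g : ℝ → ℂ} (hf : IsBoundedBorel f) (hg : IsBoundedBorel g) :
    IsBoundedBorel fun x => f x + g x := by
  obtain ⟨hfm, M, hM⟩ := hf
  obtain ⟨hgm, M', hM'⟩ := hg
  exact ⟨hfm.add hgm, M + M', fun x => (norm_add_le _ _).trans (add_le_add (hM x) (hM' x))⟩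

theorem isBoundedBorel_const (c : ℂ) : IsBoundedBorel fun _ => c :=
  ⟨measurable_const, ‖c‖, fun _ => le_rfl⟩

theorem IsBoundedBorel.const_mul {f : ℝ → ℂ} (hf : IsBoundedBorel f) (c : ℂ) :
    IsBoundedBorel fun x => c * f x :=
  (isBoundedBorel_const c).mul hf

theorem IsBoundedBorel.conj {f : ℝ → ℂ} (hf : IsBoundedBorel f) :
    IsBoundedBorel fun x => (starRingEnd ℂ) (f x) := by
  obtain ⟨hfm, M, hM⟩ := hf
  exact ⟨Complex.continuous_conj.measurable.comp hfm, M, fun x => by simpa using hM x⟩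

theorem IsBoundedBorel.integrable {f : ℝ → ℂ} (hf : IsBoundedBorel f) (μ : Measure ℝ)
    [IsFiniteMeasure μ] : Integrable f μ := by
  obtain ⟨hfm, M, hM⟩ := hf
  exact Integrable.of_bound hfm.aestronglyMeasurable M (ae_of_all _ hM)

theorem isBoundedBorel_exp (t : ℝ) :
    IsBoundedBorel fun x : ℝ => Complex.exp (-Complex.I * t * x) := by
  refine ⟨by fun_prop, 1, fun x => ?_⟩
  rw [Complex.norm_exp]
  simp

theorem exists_isBoundedBorel_truncation :
    ∃ h : ℕ → ℝ → ℂ, (∀ n, IsBoundedBorel (h n)) ∧ (∀ n x, ‖h n x‖ ≤ |x|) ∧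
      ∀ x : ℝ, Tendsto (fun n => h n x) atTop (𝓝 (x : ℂ)) := by
  refine ⟨fun n => (Set.Icc (-(n : ℝ)) n).indicator fun x => (x : ℂ), fun n => ⟨?_, n, ?_⟩, ?_, ?_⟩
  · exact (by fun_prop : Measurable fun x : ℝ => (x : ℂ)).indicator measurableSet_Icc
  · intro x
    beta_reduce
    by_cases hx : x ∈ Set.Icc (-(n : ℝ)) n
    · rw [Set.indicator_of_mem hx, Complex.norm_real]
      exact abs_le.2 hx
    · rw [Set.indicator_of_notMem hx, norm_zero]
      positivity
  · intro n x
    refine (norm_indicator_le_norm_self _ _).trans ?_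
    rw [Complex.norm_real, Real.norm_eq_abs]
  · intro x
    refine tendsto_const_nhds.congr' ?_
    filter_upwards [eventually_ge_atTop ⌈|x|⌉₊] with n hn
    have : |x| ≤ n := (Nat.le_ceil _).trans (by exact_mod_cast hn)
    rw [Set.indicator_of_mem (Set.mem_Icc.2 (abs_le.1 this))]

/-! ### The functional calculus and the spectral measure -/

section Calculus

variable {𝓗 : Type*} [NormedAddCommGroup 𝓗] [InnerProductSpace ℂ 𝓗] [CompleteSpace 𝓗]

theorem isBorelFunctionalCalculus_borelCalculus {A : 𝓗 →ₗ.[ℂ] 𝓗}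
    (h : ∃ Φ, IsBorelFunctionalCalculus A Φ) :
    IsBorelFunctionalCalculus A (borelCalculus A) := by
  rw [borelCalculus, dif_pos h]
  exact h.choose_spec

theorem spectralMeasure_apply (A : 𝓗 →ₗ.[ℂ] 𝓗) (ψ : 𝓗) {S : Set ℝ} (hS : MeasurableSet S) :
    spectralMeasure A ψ S = ENNReal.ofReal (inner ℂ ψ (spectralProjection A S ψ)).re := by
  rw [spectralMeasure, Measure.ofMeasurable_apply S hS]

instance isFiniteMeasure_spectralMeasure (A : 𝓗 →ₗ.[ℂ] 𝓗) (ψ : 𝓗) :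
    IsFiniteMeasure (spectralMeasure A ψ) :=
  ⟨by rw [spectralMeasure_apply A ψ MeasurableSet.univ]; exact ENNReal.ofReal_lt_top⟩


theorem inner_borelCalculus_mul {A : 𝓗 →ₗ.[ℂ] 𝓗}
    (hA : IsBorelFunctionalCalculus A (borelCalculus A)) {f g : ℝ → ℂ} (hf : IsBoundedBorel f) (hg : IsBoundedBorel g)
    (ψ : 𝓗) :
    inner ℂ (borelCalculus A f ψ) (borelCalculus A g ψ)
      = inner ℂ ψ (borelCalculus A (fun x => (starRingEnd ℂ) (f x) * g x) ψ) := by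
  rw [hA.map_mul _ _ hf.conj hg, hA.map_conj f hf, mul_apply_eq_comp,
    ContinuousLinearMap.adjoint_inner_right]

theorem inner_borelCalculus_indicator {A : 𝓗 →ₗ.[ℂ] 𝓗}
    (hA : IsBorelFunctionalCalculus A (borelCalculus A)) (ψ : 𝓗) {S : Set ℝ} (hS : MeasurableSet S) :
    inner ℂ ψ (borelCalculus A (S.indicator fun _ => 1) ψ)
      = ((spectralMeasure A ψ).real S : ℂ) := by
  have hb := isBoundedBorel_indicator hS
  rw [measureReal_def, spectralMeasure_apply A ψ hS,
    ENNReal.toReal_ofReal (inner_spectralProjection_nonneg A ψ hS), spectralProjection]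
  have h := inner_borelCalculus_mul hA hb hb ψ
  have h1 : (fun x => (starRingEnd ℂ) (S.indicator (fun _ => (1 : ℂ)) x)
      * S.indicator (fun _ => 1) x) = S.indicator fun _ => 1 := by
    funext x; by_cases hx : x ∈ S <;> simp [hx]
  rw [h1] at h
  rw [← h, inner_self_eq_norm_sq_to_K]
  norm_cast

theorem inner_borelCalculus_simpleFunc {A : 𝓗 →ₗ.[ℂ] 𝓗}
    (hA : IsBorelFunctionalCalculus A (borelCalculus A)) (ψ : 𝓗) (f : SimpleFunc ℝ ℂ) :
    inner ℂ ψ (borelCalculus A f ψ) = ∫ x, f x ∂spectralMeasure A ψ := by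
  have hbd : ∀ g : SimpleFunc ℝ ℂ, IsBoundedBorel g := fun g =>
    ⟨g.measurable, g.exists_forall_norm_le⟩
  induction f using SimpleFunc.induction with
  | const c hs =>
    rename_i s
    have hfun : (⇑(SimpleFunc.piecewise s hs (SimpleFunc.const ℝ c) (SimpleFunc.const ℝ 0)))
        = fun x => c * s.indicator (fun _ => 1) x := by
      funext x; by_cases hx : x ∈ s <;> simp [hx]
    rw [hfun, hA.map_smul c _ (isBoundedBorel_indicator hs), smul_apply,
      inner_smul_right, inner_borelCalculus_indicator hA ψ hs, integral_const_mul,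
      integral_indicator hs]
    simp
  | add _ ihf ihg =>
    rename_i f g _
    have hfun : ⇑(f + g) = fun x => f x + g x := rfl
    rw [hfun, hA.map_add _ _ (hbd f) (hbd g), add_apply, inner_add_right, ihf, ihg,
      integral_add ((hbd f).integrable _) ((hbd g).integrable _)]

/-- The identity passes from indicators to simple functions by linearity, then to bounded Borel
functions because bounded pointwise limits are respected on both sides. -/
theorem inner_borelCalculus_eq_integral {A : 𝓗 →ₗ.[ℂ] 𝓗}
    (hA : IsBorelFunctionalCalculus A (borelCalculus A)) (ψ : 𝓗) {f : ℝ → ℂ} (hf : IsBoundedBorel f) :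
    inner ℂ ψ (borelCalculus A f ψ) = ∫ x, f x ∂spectralMeasure A ψ := by
  obtain ⟨hfm, M, hM⟩ := hf
  have hM0 : 0 ≤ M := (norm_nonneg _).trans (hM 0)
  have hs := hfm.stronglyMeasurable
  have hbd := fun n x => hs.norm_approxBounded_le hM0 n x
  have h1 := hA.tendsto_of_bounded (fun n => hs.approxBounded M n) f M
    (fun n => (hs.approxBounded M n).measurable) hfm hbd
    (fun x => hs.tendsto_approxBounded_of_norm_le (hM x)) ψ
  have h2 := (tendsto_const_nhds (x := ψ)).inner (𝕜 := ℂ) h1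
  have h3 := tendsto_integral_of_dominated_convergence (μ := spectralMeasure A ψ) (fun _ => M)
    (fun n => (hs.approxBounded M n).measurable.aestronglyMeasurable) (integrable_const _)
    (fun n => ae_of_all _ (hbd n))
    (ae_of_all _ fun x => hs.tendsto_approxBounded_of_norm_le (hM x))
  simp only [inner_borelCalculus_simpleFunc hA] at h2
  exact tendsto_nhds_unique h2 h3

theorem norm_borelCalculus_sq {A : 𝓗 →ₗ.[ℂ] 𝓗}
    (hA : IsBorelFunctionalCalculus A (borelCalculus A)) (ψ : 𝓗) {f : ℝ → ℂ} (hf : IsBoundedBorel f) :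
    ‖borelCalculus A f ψ‖ ^ 2 = ∫ x, ‖f x‖ ^ 2 ∂spectralMeasure A ψ := by
  have h := inner_borelCalculus_mul hA hf hf ψ
  rw [inner_borelCalculus_eq_integral hA ψ (hf.conj.mul hf), inner_self_eq_norm_sq_to_K] at h
  simp only [Complex.conj_mul'] at h
  rw [← Complex.ofReal_inj, ← integral_complex_ofReal]
  push_cast
  exact h

end Calculus

/-! ### Coordinates -/

/-- The unit vector at the site `n`, which is `0` for `n = 0`. -/
noncomputable def unitVector (n : ℕ) : HalfLine :=
  if h : 0 < n then lp.single 2 (n.toPNat h) 1 else 0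

theorem unitVector_one : unitVector 1 = deltaOne := rfl

theorem inner_unitVector (n : ℕ) (v : HalfLine) : inner ℂ (unitVector n) v = zeroExtend v n := by
  unfold unitVector zeroExtend
  split_ifs with h
  · rw [lp.inner_single_left]; simp
  · exact inner_zero_left _

theorem unitVector_apply (n : ℕ) (j : ℕ+) :
    (unitVector n : ℕ+ → ℂ) j = if (j : ℕ) = n then 1 else 0 := by
  unfold unitVector
  split_ifs with h1 h2 h2
  · subst h2
    rw [lp.single_apply]
    exact Pi.single_eq_same _ _
  · rw [lp.single_apply, Pi.single_eq_of_ne]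
    rintro rfl
    exact h2 rfl
  · exact absurd (h2 ▸ j.pos) h1
  · rfl

theorem zeroExtend_unitVector (n m : ℕ) :
    zeroExtend (unitVector n) m = if m = n ∧ 0 < m then 1 else 0 := by
  unfold zeroExtend
  split_ifs with h1 h2 h2
  · rw [unitVector_apply]; exact if_pos h2.1
  · rw [unitVector_apply]; exact if_neg fun h => h2 ⟨h, h1⟩
  · exact absurd h2.2 h1
  · rfl

@[simp]
theorem zeroExtend_zero_right (v : ℕ+ → ℂ) : zeroExtend v 0 = 0 := by simp [zeroExtend]

theorem zeroExtend_coe (v : ℕ+ → ℂ) (k : ℕ+) : zeroExtend v k = v k := by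
  rw [zeroExtend, dif_pos k.pos]; rfl

theorem jacobiExpr_unitVector (a b : ℕ → ℝ) {k : ℕ} (hk : 0 < k) :
    jacobiExpr a b (unitVector k) = (((a k : ℂ) • unitVector (k + 1)
      + (a (k - 1) : ℂ) • unitVector (k - 1) + (b k : ℂ) • unitVector k : HalfLine) : ℕ+ → ℂ) := by
  funext j
  have hj := j.pos
  simp only [jacobiExpr, zeroExtend_unitVector, lp.coeFn_add, lp.coeFn_smul, Pi.add_apply,
    Pi.smul_apply, unitVector_apply, smul_eq_mul]
  generalize (j : ℕ) = j at hj ⊢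
  rcases lt_trichotomy j k with h | h | h
  · by_cases h' : j + 1 = k
    · subst h'
      simp [show ¬ (j - 1 = j + 1) by omega]
      omega
    · simp [h', h.ne, show ¬ (j = k - 1) by omega, show ¬ (j - 1 = k) by omega,
        show ¬ (j = k + 1) by omega]
  · subst h
    simp [hj, show ¬ (j = j - 1) by omega, show ¬ (j - 1 = j) by omega]
  · by_cases h' : j = k + 1
    · subst h'
      simp [hk, show ¬ (k + 1 + 1 = k) by omega, show ¬ (k + 1 = k - 1) by omega]
    · simp [h', h.ne', show ¬ (j = k - 1) by omega, show ¬ (j - 1 = k) by omega,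
        show ¬ (j + 1 = k) by omega]

theorem unitVector_mem_domain (a b : ℕ → ℝ) {k : ℕ} (hk : 0 < k) :
    unitVector k ∈ (jacobiOperator a b).domain := by
  change Memℓp (jacobiExpr a b (unitVector k : ℕ+ → ℂ)) 2
  rw [jacobiExpr_unitVector a b hk]
  exact lp.memℓp _

/-- Symmetry of the matrix, tested on unit vectors; `v` is not required to lie in the domain. -/
theorem inner_jacobiOperator_unitVector (a b : ℕ → ℝ) (k : ℕ+) (v : HalfLine) :
    inner ℂ (jacobiOperator a b ⟨unitVector k, unitVector_mem_domain a b k.pos⟩) v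
      = jacobiExpr a b v k := by
  have h : jacobiOperator a b ⟨unitVector k, unitVector_mem_domain a b k.pos⟩
      = (a k : ℂ) • unitVector (k + 1) + (a (k - 1) : ℂ) • unitVector (k - 1)
        + (b k : ℂ) • unitVector k :=
    Subtype.ext (jacobiExpr_unitVector a b k.pos)
  rw [h]
  simp only [inner_add_left, inner_smul_left, inner_unitVector, Complex.conj_ofReal, jacobiExpr]

/-- Coordinatewise `H f(H) = (x f)(H)`, without first placing `f(H)ψ` in the domain. Truncations of
`x` applied to a unit vector converge to `H` of it; moved to the other side of the inner product
they become truncations of `x f`, dominated by the bound of `x f`. -/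
theorem jacobiExpr_borelCalculus {a b : ℕ → ℝ}
    (hH : IsBorelFunctionalCalculus (jacobiOperator a b) (borelCalculus (jacobiOperator a b)))
    {f : ℝ → ℂ} (hf : IsBoundedBorel f)
    (hxf : IsBoundedBorel fun x => x * f x) (ψ : HalfLine) (k : ℕ+) :
    jacobiExpr a b (borelCalculus (jacobiOperator a b) f ψ : HalfLine) k
      = zeroExtend (borelCalculus (jacobiOperator a b) (fun x => x * f x) ψ : HalfLine) k := by
  set Φ := borelCalculus (jacobiOperator a b)
  obtain ⟨h, hb, hle, hlim⟩ := exists_isBoundedBorel_truncation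
  obtain ⟨hxm, M, hM⟩ := hxf
  have h1 := (hH.tendsto_operator h hb hle hlim
    ⟨unitVector k, unitVector_mem_domain a b k.pos⟩).inner (𝕜 := ℂ)
    (tendsto_const_nhds (x := Φ f ψ))
  rw [inner_jacobiOperator_unitVector] at h1
  have h2 := hH.tendsto_of_bounded (fun n x => (starRingEnd ℂ) (h n x) * f x)
    (fun x => x * f x) M (fun n => ((hb n).conj.mul hf).1) hxm
    (fun n x => by
      refine le_trans ?_ (hM x)
      rw [norm_mul, norm_mul, RCLike.norm_conj, Complex.norm_real]
      exact mul_le_mul_of_nonneg_right (hle n x) (norm_nonneg _))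
    (fun x => by
      have := (Complex.continuous_conj.tendsto _).comp (hlim x)
      rw [Complex.conj_ofReal] at this
      exact this.mul_const _) ψ
  have h3 := (tendsto_const_nhds (x := unitVector k)).inner (𝕜 := ℂ) h2
  rw [inner_unitVector] at h3
  refine tendsto_nhds_unique h1 (h3.congr fun n => ?_)
  rw [hH.map_mul _ _ (hb n).conj hf, hH.map_conj _ (hb n), mul_apply_eq_comp,
    ContinuousLinearMap.adjoint_inner_right]

theorem zeroExtend_one_borelCalculus {a b : ℕ → ℝ}
    (hH : IsBorelFunctionalCalculus (jacobiOperator a b) (borelCalculus (jacobiOperator a b)))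
    {f : ℝ → ℂ} (hf : IsBoundedBorel f) :
    zeroExtend (borelCalculus (jacobiOperator a b) f deltaOne : HalfLine) 1
      = ∫ x, f x ∂spectralMeasure (jacobiOperator a b) deltaOne := by
  rw [← inner_borelCalculus_eq_integral hH _ hf, ← unitVector_one, inner_unitVector]

theorem continuous_solution (a b : ℕ → ℝ) (θ : ℝ) (n : ℕ) :
    Continuous fun E => solution a b θ E n := by
  induction n using Nat.twoStepInduction with
  | zero => simp only [solution]; fun_prop
  | one => simp only [solution]; fun_prop
  | more n h0 h1 => simp only [solution]; fun_prop

theorem isBoundedBorel_continuous_mul_of_support {g f : ℝ → ℂ} (hg : Continuous g)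
    (hf : IsBoundedBorel f) {R : ℝ} (hR : ∀ x, R < |x| → f x = 0) :
    IsBoundedBorel fun x => g x * f x := by
  obtain ⟨hfm, M, hM⟩ := hf
  obtain ⟨M', hM'⟩ := (isCompact_Icc (a := -R) (b := R)).exists_bound_of_continuousOn hg.continuousOn
  refine ⟨hg.measurable.mul hfm, max M' 0 * M, fun x => ?_⟩
  have hM0 := (norm_nonneg _).trans (hM x)
  beta_reduce
  rcases lt_or_ge R |x| with h | h
  · rw [hR x h, mul_zero, norm_zero]; positivity
  · rw [norm_mul]
    exact mul_le_mul ((hM' x (abs_le.1 h)).trans (le_max_left _ _)) (hM x) (norm_nonneg _)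
      (le_max_right _ _)

/-- Expansion in generalized eigenfunctions. -/
theorem zeroExtend_borelCalculus_eq_integral {a b : ℕ → ℝ}
    (hH : IsBorelFunctionalCalculus (jacobiOperator a b) (borelCalculus (jacobiOperator a b)))
    (ha : ∀ n, a n ≠ 0) {R : ℝ} {f : ℝ → ℂ} (hf : IsBoundedBorel f)
    (hR : ∀ x, R < |x| → f x = 0) (n : ℕ) :
    zeroExtend (borelCalculus (jacobiOperator a b) f deltaOne : HalfLine) n
      = ∫ x, solution a b 0 x n * f x ∂spectralMeasure (jacobiOperator a b) deltaOne := by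
  have hc : ∀ n, Continuous fun x => (solution a b 0 x n : ℂ) := fun n =>
    Complex.continuous_ofReal.comp (continuous_solution a b 0 n)
  -- The recurrence calls for the formula with `x f` in place of `f`; bounded support keeps `x f` in
  -- the admissible class.
  induction n using Nat.twoStepInduction generalizing f with
  | zero => simp [solution]
  | one => rw [zeroExtend_one_borelCalculus hH hf]; simp [solution]
  | more n ih0 ih1 =>
    have hxf : IsBoundedBorel fun x => x * f x :=
      isBoundedBorel_continuous_mul_of_support Complex.continuous_ofReal hf hR
    have h := jacobiExpr_borelCalculus hH hf hxf deltaOne n.succPNat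
    simp only [jacobiExpr, Nat.succPNat_coe, Nat.succ_eq_add_one, Nat.add_sub_cancel] at h
    rw [ih0 hf hR, ih1 hf hR, ih1 hxf fun x hx => by rw [hR x hx, mul_zero]] at h
    have ha' : (a (n + 1) : ℂ) ≠ 0 := by exact_mod_cast ha (n + 1)
    have hi : ∀ k, Integrable (fun x => solution a b 0 x k * f x)
        (spectralMeasure (jacobiOperator a b) deltaOne) := fun k =>
      (isBoundedBorel_continuous_mul_of_support (hc k) hf hR).integrable _
    have hi' : Integrable (fun x => solution a b 0 x (n + 1) * (x * f x))
        (spectralMeasure (jacobiOperator a b) deltaOne) :=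
      (isBoundedBorel_continuous_mul_of_support (hc (n + 1)) hxf
        fun x hx => by rw [hR x hx, mul_zero]).integrable _
    apply mul_left_cancel₀ ha'
    rw [← integral_const_mul]
    have hpt : ∀ x : ℝ, (a (n + 1) : ℂ) * (solution a b 0 x (n + 2) * f x)
        = solution a b 0 x (n + 1) * (x * f x) - a n * (solution a b 0 x n * f x)
          - b (n + 1) * (solution a b 0 x (n + 1) * f x) := by
      intro x
      have : (a (n + 1) : ℂ) * solution a b 0 x (n + 2)
          = (x - b (n + 1)) * solution a b 0 x (n + 1) - a n * solution a b 0 x n := by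
        exact_mod_cast solution_add_two a b ha 0 x n
      linear_combination f x * this
    simp only [hpt]
    have hi2 : Integrable (fun x => solution a b 0 x (n + 1) * (x * f x)
        - a n * (solution a b 0 x n * f x)) (spectralMeasure (jacobiOperator a b) deltaOne) :=
      hi'.sub ((hi n).const_mul _)
    rw [integral_sub hi2 ((hi (n + 1)).const_mul (b (n + 1))),
      integral_sub hi' ((hi n).const_mul _), integral_const_mul, integral_const_mul]
    linear_combination h

/-! ### The Poisson transform of the spectral measure -/

theorem sum_norm_zeroExtend_sq_le (v : HalfLine) (N : ℕ) :
    ∑ n ∈ Finset.Icc 1 N, ‖zeroExtend v n‖ ^ 2 ≤ ‖v‖ ^ 2 := by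
  have h := lp.sum_rpow_le_norm_rpow (p := 2) (by norm_num) v
    ((Finset.range N).map ⟨Nat.succPNat, Nat.succPNat_injective⟩)
  simp only [ENNReal.toReal_ofNat, Real.rpow_ofNat, Finset.sum_map,
    Function.Embedding.coeFn_mk] at h
  refine le_trans (le_of_eq ?_) h
  rw [Finset.range_eq_Ico, ← Finset.Ico_add_one_right_eq_Icc,
    ← Finset.sum_Ico_add' (fun n => ‖zeroExtend v n‖ ^ 2) 0 N 1]
  exact Finset.sum_congr rfl fun n _ => by rw [← zeroExtend_coe v n.succPNat]; rfl

theorem normSqUpTo_le_norm_sq {v : HalfLine} {φ : ℕ → ℂ}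
    (h : ∀ n, 0 < n → φ n = zeroExtend v n) {L : ℝ} (hL : 0 ≤ L) :
    normSqUpTo φ L ≤ ‖v‖ ^ 2 := by
  rw [normSqUpTo_eq_sum φ hL (Nat.le_ceil L)]
  refine le_trans (Finset.sum_le_sum fun n hn => ?_) (sum_norm_zeroExtend_sq_le v ⌈L⌉₊)
  rw [h n (Finset.mem_Icc.1 hn).1]
  exact mul_le_of_le_one_left (sq_nonneg _) (siteWeight_le_one _ _)

/-- The Poisson integral `∫ ((x - E)² + ε²)⁻¹ dμ(x)`. -/
noncomputable def poisson (μ : Measure ℝ) (ε E : ℝ) : ℝ := ∫ x, ((x - E) ^ 2 + ε ^ 2)⁻¹ ∂μ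

theorem poisson_nonneg (μ : Measure ℝ) (ε E : ℝ) : 0 ≤ poisson μ ε E :=
  integral_nonneg fun _ => by positivity

theorem measurable_poisson (μ : Measure ℝ) [SFinite μ] (ε : ℝ) : Measurable (poisson μ ε) := by
  have h : StronglyMeasurable fun p : ℝ × ℝ => ((p.2 - p.1) ^ 2 + ε ^ 2)⁻¹ :=
    Measurable.stronglyMeasurable (by fun_prop)
  exact h.integral_prod_right'.measurable

theorem normSq_resolvent (E ε x : ℝ) :
    Complex.normSq (x - (E + Complex.I * ε)) = (x - E) ^ 2 + ε ^ 2 := by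
  simp [Complex.normSq_apply]; ring

theorem isBoundedBorel_resolvent {z : ℂ} (hz : z.im ≠ 0) :
    IsBoundedBorel fun x : ℝ => ((x : ℂ) - z)⁻¹ := by
  refine ⟨by fun_prop, |z.im|⁻¹, fun x => ?_⟩
  rw [norm_inv]
  refine inv_anti₀ (abs_pos.2 hz) ?_
  simpa using Complex.abs_im_le_norm ((x : ℂ) - z)

theorem mul_resolvent {z : ℂ} (hz : z.im ≠ 0) (x : ℝ) :
    (x : ℂ) * ((x : ℂ) - z)⁻¹ = 1 + z * ((x : ℂ) - z)⁻¹ := by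
  have hxz : (x : ℂ) - z ≠ 0 := fun h => hz (by simpa using congrArg Complex.im h)
  field_simp
  ring

/-- The bound on the Poisson integral of the spectral measure by the solution `u_0`. -/
theorem sq_mul_poisson_mul_normSqUpTo_le {a b : ℕ → ℝ}
    (hH : IsBorelFunctionalCalculus (jacobiOperator a b) (borelCalculus (jacobiOperator a b)))
    (ha : ∀ n, a n ≠ 0) (ha0 : a 0 = 1) (E : ℝ) {ε : ℝ} (hε : 0 < ε) {L : ℝ} (hL : 0 ≤ L) :
    ε ^ 2 * poisson (spectralMeasure (jacobiOperator a b) deltaOne) ε E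
        * normSqUpTo (solution a b 0 E) L
      ≤ (1 + ε * scaleProduct a b E L) ^ 2 := by
  set μ := spectralMeasure (jacobiOperator a b) deltaOne
  set P := poisson μ ε E with hP
  set z : ℂ := E + Complex.I * ε with hz
  have hzim : z.im ≠ 0 := by simpa [hz] using hε.ne'
  set r : ℝ → ℂ := fun x => ((x : ℂ) - z)⁻¹ with hrdef
  have hr : IsBoundedBorel r := isBoundedBorel_resolvent hzim
  have hns : ∀ x : ℝ, Complex.normSq (x - z) = (x - E) ^ 2 + ε ^ 2 := normSq_resolvent E ε
  have hxr : (fun x : ℝ => (x : ℂ) * r x) = fun x => 1 + z * r x :=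
    funext fun x => mul_resolvent hzim x
  have hxrb : IsBoundedBorel fun x : ℝ => (x : ℂ) * r x := by
    rw [hxr]; exact (isBoundedBorel_const 1).add (hr.const_mul z)
  set v : HalfLine := borelCalculus (jacobiOperator a b) r deltaOne with hv
  -- Since `a 0 = 1`, the value `-1` at site `0` absorbs the source `δ_1` of `(H - z) v = δ_1`, so
  -- the homogeneous recurrence also holds at the first site.
  set φ : ℕ → ℂ := fun n => if n = 0 then -1 else zeroExtend v n with hφdef
  have hφs : ∀ n, φ (n + 1) = zeroExtend v (n + 1) := fun n => by simp [hφdef]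
  have hrec : ∀ n, a (n + 1) * φ (n + 2) + a n * φ n + b (n + 1) * φ (n + 1)
      = (E + Complex.I * ε) * φ (n + 1) := by
    intro n
    have h := jacobiExpr_borelCalculus hH hr hxrb deltaOne n.succPNat
    rw [hxr, hH.map_add _ _ (isBoundedBorel_const 1) (hr.const_mul z), hH.map_one,
      hH.map_smul z r hr, ← inner_unitVector, add_apply, smul_apply, one_apply_eq_self,
      inner_add_right, inner_smul_right, inner_unitVector, inner_unitVector, ← unitVector_one,
      zeroExtend_unitVector, unitVector_one] at h
    simp only [jacobiExpr, Nat.succPNat_coe, Nat.succ_eq_add_one, Nat.add_sub_cancel] at h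
    rw [hφs (n + 1), hφs n]
    rcases n with _ | n
    · simp [hφdef, ha0] at h ⊢
      linear_combination h
    · rw [hφs n]
      simp at h
      linear_combination h
  have hnorm : ‖v‖ ^ 2 = P := by
    rw [hv, norm_borelCalculus_sq hH _ hr, hP, poisson]
    refine integral_congr_ae (ae_of_all _ fun x => ?_)
    simp only [hrdef]
    rw [norm_inv, inv_pow, Complex.sq_norm, hns]
  -- `φ 1` is the Stieltjes transform of the spectral measure, and its imaginary part is the Poisson
  -- integral up to the factor `ε`.
  have him : (φ 1).im = ε * P := by
    rw [hφs 0, zero_add, hv, zeroExtend_one_borelCalculus hH hr]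
    rw [show (∫ x, r x ∂μ).im = ∫ x, (r x).im ∂μ from (integral_im (hr.integrable μ)).symm]
    rw [hP, poisson, ← integral_const_mul]
    refine integral_congr_ae (ae_of_all _ fun x => ?_)
    simp only [hrdef]
    rw [Complex.inv_im, hns, div_eq_mul_inv]
    congr 1
    simp [hz]
  have h := im_sq_mul_normSqUpTo_le a b ha ha0 E (Complex.I * ε) φ (by simp [hφdef]) hrec hL
  have hle : normSqUpTo φ L ≤ P := hnorm ▸ normSqUpTo_le_norm_sq
    (fun n hn => by simp [hφdef, hn.ne']) hL
  rw [him, norm_mul, Complex.norm_I, one_mul, Complex.norm_real, Real.norm_of_nonneg hε.le] at h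
  have hP0 : 0 ≤ P := poisson_nonneg _ _ _
  -- The bound obtained is quadratic in `P` on the left and linear on the right; one factor `P` is
  -- cancelled.
  rcases hP0.eq_or_lt with h0 | h0
  · rw [← h0]; simp only [mul_zero, zero_mul]; positivity
  · refine le_of_mul_le_mul_right ?_ h0
    calc _ = (ε * P) ^ 2 * normSqUpTo (solution a b 0 E) L := by ring
      _ ≤ _ := h
      _ ≤ _ := mul_le_mul_of_nonneg_left hle (sq_nonneg _)

/-! ### Abelian time averages of Fourier transforms -/

theorem integral_exp_neg_mul_cos_Ioi {ε : ℝ} (hε : 0 < ε) (s : ℝ) :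
    ∫ t in Set.Ioi (0 : ℝ), Real.exp (-ε * t) * Real.cos (t * s) = ε * (s ^ 2 + ε ^ 2)⁻¹ := by
  set w : ℂ := -ε + s * Complex.I
  have hw : w.re < 0 := by simp [w, hε]
  have h := integral_exp_mul_complex_Ioi hw 0
  have hi := integrableOn_exp_mul_complex_Ioi hw 0
  have hre : ∀ t : ℝ, (Complex.exp (w * t)).re = Real.exp (-ε * t) * Real.cos (t * s) := by
    intro t
    rw [Complex.exp_re]
    simp [w, mul_comm]
  calc _ = ∫ t in Set.Ioi (0 : ℝ), (Complex.exp (w * t)).re := by simp only [hre]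
    _ = (∫ t in Set.Ioi (0 : ℝ), Complex.exp (w * t)).re := integral_re hi
    _ = _ := by
      rw [h]
      simp [w, Complex.normSq_apply, Complex.div_re]
      field_simp
      ring

/-- The real form, with a cosine of the difference, leaves an elementary `t`-integral after Fubini.
-/
theorem norm_integral_exp_mul_sq (μ : Measure ℝ) [IsFiniteMeasure μ] {f : ℝ → ℝ}
    (hf : Measurable f) {M : ℝ} (hM : ∀ x, |f x| ≤ M) (t : ℝ) :
    ‖∫ x, Complex.exp (-Complex.I * t * x) * f x ∂μ‖ ^ 2
      = ∫ p : ℝ × ℝ, Real.cos (t * (p.1 - p.2)) * (f p.1 * f p.2) ∂μ.prod μ := by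
  have hint : Integrable (fun x : ℝ => Complex.exp (-Complex.I * t * x) * f x) μ :=
    ((isBoundedBorel_exp t).mul ⟨by fun_prop, M, fun x => by
      rw [Complex.norm_real]; exact hM x⟩ : IsBoundedBorel _).integrable μ
  have hc : ∀ g : ℝ → ℝ, Measurable g → (∀ x, |g x| ≤ 1) →
      Integrable (fun x => g x * f x) μ := fun g hg hg1 =>
    Integrable.of_bound (hg.mul hf).aestronglyMeasurable M <| ae_of_all _ fun x => by
      rw [Real.norm_eq_abs, abs_mul]
      exact (mul_le_of_le_one_left (abs_nonneg _) (hg1 x)).trans (hM x)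
  have hcos := hc (fun x => Real.cos (t * x)) (by fun_prop) fun x => Real.abs_cos_le_one _
  have hsin := hc (fun x => Real.sin (t * x)) (by fun_prop) fun x => Real.abs_sin_le_one _
  have hexp : ∀ x : ℝ, Complex.exp (-Complex.I * t * x)
      = ⟨Real.cos (t * x), -Real.sin (t * x)⟩ := by
    intro x
    apply Complex.ext
    · rw [Complex.exp_re]; simp
    · rw [Complex.exp_im]; simp
  have hre : (∫ x, Complex.exp (-Complex.I * t * x) * f x ∂μ).re
      = ∫ x, Real.cos (t * x) * f x ∂μ := by
    rw [show (∫ x, Complex.exp (-Complex.I * t * x) * f x ∂μ).re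
      = ∫ x, (Complex.exp (-Complex.I * t * x) * f x).re ∂μ from (integral_re hint).symm]
    simp only [hexp]
    simp
  have him : (∫ x, Complex.exp (-Complex.I * t * x) * f x ∂μ).im
      = -∫ x, Real.sin (t * x) * f x ∂μ := by
    rw [show (∫ x, Complex.exp (-Complex.I * t * x) * f x ∂μ).im
      = ∫ x, (Complex.exp (-Complex.I * t * x) * f x).im ∂μ from (integral_im hint).symm,
      ← integral_neg]
    simp only [hexp]
    simp
  rw [Complex.sq_norm, Complex.normSq_apply, hre, him, neg_mul_neg,
    ← integral_prod_mul (L := ℝ), ← integral_prod_mul (L := ℝ),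
    ← integral_add (hcos.mul_prod hcos) (hsin.mul_prod hsin)]
  refine integral_congr_ae (ae_of_all _ fun p => ?_)
  simp only [mul_sub, Real.cos_sub]
  ring

/-- The Abelian time average of the Fourier transform of `f μ` is bounded by a Schur test. -/
theorem lintegral_exp_mul_norm_integral_sq_le (μ : Measure ℝ) [IsFiniteMeasure μ] {f : ℝ → ℝ}
    (hf : Measurable f) {M : ℝ} (hM : ∀ x, |f x| ≤ M) {ε : ℝ} (hε : 0 < ε) :
    ∫⁻ t in Set.Ioi (0 : ℝ), ENNReal.ofReal (ε * (Real.exp (-ε * t) *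
        ‖∫ x, Complex.exp (-Complex.I * t * x) * f x ∂μ‖ ^ 2))
      ≤ ∫⁻ E, ENNReal.ofReal (f E ^ 2 * (ε ^ 2 * poisson μ ε E)) ∂μ := by
  have hM0 : 0 ≤ M := (abs_nonneg _).trans (hM 0)
  set F : ℝ → ℝ × ℝ → ℝ := fun t p =>
    ε * (Real.exp (-ε * t) * (Real.cos (t * (p.1 - p.2)) * (f p.1 * f p.2))) with hF
  have hFm : Measurable (Function.uncurry F) := by
    simp only [hF, Function.uncurry_def]; fun_prop
  have hexpi : Integrable (fun t : ℝ => ε * Real.exp (-ε * t))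
      (volume.restrict (Set.Ioi (0 : ℝ))) := (exp_neg_integrableOn_Ioi 0 hε).const_mul ε
  have hFi : Integrable (Function.uncurry F) ((volume.restrict (Set.Ioi (0 : ℝ))).prod (μ.prod μ)) := by
    refine Integrable.mono' (hexpi.mul_prod (integrable_const (M * M) : Integrable _ (μ.prod μ)))
      hFm.aestronglyMeasurable (ae_of_all _ fun q => ?_)
    obtain ⟨t, x, y⟩ := q
    simp only [hF, Function.uncurry_apply_pair, Real.norm_eq_abs, abs_mul, abs_of_pos hε,
      Real.abs_exp]
    rw [← mul_assoc]
    refine mul_le_mul_of_nonneg_left ?_ (by positivity)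
    refine (mul_le_of_le_one_left (by positivity) (Real.abs_cos_le_one _)).trans ?_
    exact mul_le_mul (hM x) (hM y) (abs_nonneg _) hM0
  have hinner : ∀ t, ∫ p, F t p ∂μ.prod μ = ε * (Real.exp (-ε * t) *
        ‖∫ x, Complex.exp (-Complex.I * t * x) * f x ∂μ‖ ^ 2) := by
    intro t
    rw [norm_integral_exp_mul_sq μ hf hM, ← integral_const_mul, ← integral_const_mul]
  set K : ℝ × ℝ → ℝ := fun p => ε ^ 2 * ((p.2 - p.1) ^ 2 + ε ^ 2)⁻¹ with hK
  have hK0 : ∀ p, 0 ≤ K p := fun p => by simp only [hK]; positivity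
  have hK1 : ∀ p, K p ≤ 1 := fun p => by
    simp only [hK]
    rw [← div_eq_mul_inv, div_le_one (by positivity)]
    nlinarith [sq_nonneg (p.2 - p.1)]
  have hKm : Measurable K := by simp only [hK]; fun_prop
  have hswap : ∀ p : ℝ × ℝ, ∫ t in Set.Ioi (0 : ℝ), F t p = f p.1 * f p.2 * K p := by
    intro p
    simp only [hF, ← mul_assoc]
    rw [integral_mul_const, integral_mul_const]
    simp only [mul_assoc]
    rw [integral_const_mul, integral_exp_neg_mul_cos_Ioi hε, hK, sub_sq_comm p.1 p.2]
    ring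
  have hb : ∀ g : ℝ × ℝ → ℝ, Measurable g → (∀ p, |g p| ≤ M * M) →
      Integrable (fun p => g p * K p) (μ.prod μ) := fun g hg hgM =>
    Integrable.of_bound (hg.mul hKm).aestronglyMeasurable (M * M) <| ae_of_all _ fun p => by
      rw [Real.norm_eq_abs, abs_mul, abs_of_nonneg (hK0 p)]
      exact (mul_le_of_le_one_right (abs_nonneg _) (hK1 p)).trans (hgM p)
  have hsq : ∀ x, |f x ^ 2| ≤ M * M := fun x => by
    rw [sq, abs_mul]; exact mul_le_mul (hM x) (hM x) (abs_nonneg _) hM0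
  have hi1 := hb (fun p => f p.1 ^ 2) (by fun_prop) fun p => hsq p.1
  have hi2 := hb (fun p => f p.2 ^ 2) (by fun_prop) fun p => hsq p.2
  have hi3 := hb (fun p => f p.1 * f p.2) (by fun_prop) fun p => by
    rw [abs_mul]; exact mul_le_mul (hM _) (hM _) (abs_nonneg _) hM0
  have hsym : ∫ p, f p.2 ^ 2 * K p ∂μ.prod μ = ∫ p, f p.1 ^ 2 * K p ∂μ.prod μ := by
    rw [← integral_prod_swap]
    simp only [Prod.fst_swap, Prod.snd_swap, hK]
    refine integral_congr_ae (ae_of_all _ fun p => ?_)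
    simp only [sub_sq_comm p.1 p.2]
  -- From `2 f(x) f(y) ≤ f(x)² + f(y)²` and the symmetry of the nonnegative kernel.
  have hschur : ∫ p, f p.1 * f p.2 * K p ∂μ.prod μ ≤ ∫ p, f p.1 ^ 2 * K p ∂μ.prod μ := by
    have h := integral_mono (hi3.const_mul 2) (hi1.add hi2) fun p => by
      simp only [Pi.add_apply]
      nlinarith [mul_nonneg (sq_nonneg (f p.1 - f p.2)) (hK0 p)]
    rw [integral_add' hi1 hi2, hsym, integral_const_mul] at h
    linarith
  have hiter : ∫ p, f p.1 ^ 2 * K p ∂μ.prod μ = ∫ E, f E ^ 2 * (ε ^ 2 * poisson μ ε E) ∂μ := by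
    rw [integral_prod _ hi1]
    refine integral_congr_ae (ae_of_all _ fun E => ?_)
    simp only [hK, poisson]
    rw [integral_const_mul, integral_const_mul]
  have hi4 : Integrable (fun E => f E ^ 2 * (ε ^ 2 * poisson μ ε E)) μ := by
    refine hi1.integral_prod_left.congr (ae_of_all _ fun E => ?_)
    simp only [hK, poisson]
    rw [integral_const_mul, integral_const_mul]
  have hi5 := hFi.integral_prod_left
  simp only [Function.uncurry_apply_pair, hinner] at hi5
  rw [← ofReal_integral_eq_lintegral_ofReal hi5 (ae_of_all _ fun t => by positivity),
    ← ofReal_integral_eq_lintegral_ofReal hi4 (ae_of_all _ fun E =>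
      mul_nonneg (sq_nonneg _) (mul_nonneg (sq_nonneg _) (poisson_nonneg _ _ _)))]
  refine ENNReal.ofReal_le_ofReal ?_
  simp only [← hinner]
  rw [integral_integral_swap hFi]
  simp only [hswap]
  exact hschur.trans_eq hiter

/-! ### Time averages of the wave packet -/

theorem measurable_integral_exp_mul (μ : Measure ℝ) [SFinite μ] {f : ℝ → ℝ} (hf : Measurable f) :
    Measurable fun t : ℝ => ∫ x, Complex.exp (-Complex.I * t * x) * f x ∂μ := by
  have h : StronglyMeasurable fun p : ℝ × ℝ => Complex.exp (-Complex.I * p.1 * p.2) * f p.2 :=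
    Measurable.stronglyMeasurable (by fun_prop)
  exact h.integral_prod_right'.measurable

theorem lintegral_sum_weight_mul_le (μ : Measure ℝ) [IsFiniteMeasure μ] (s : Finset ℕ)
    {c : ℕ → ℝ} (hc : ∀ n, 0 ≤ c n) {f : ℕ → ℝ → ℝ} (hf : ∀ n, Measurable (f n))
    (hM : ∀ n, ∃ M, ∀ x, |f n x| ≤ M) {ε : ℝ} (hε : 0 < ε) :
    ∫⁻ t in Set.Ioi (0 : ℝ), ENNReal.ofReal (ε * (Real.exp (-ε * t) *
        ∑ n ∈ s, c n * ‖∫ x, Complex.exp (-Complex.I * t * x) * f n x ∂μ‖ ^ 2))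
      ≤ ∫⁻ E, ENNReal.ofReal ((∑ n ∈ s, c n * f n E ^ 2) * (ε ^ 2 * poisson μ ε E)) ∂μ := by
  have hP : ∀ E, 0 ≤ ε ^ 2 * poisson μ ε E := fun E =>
    mul_nonneg (sq_nonneg _) (poisson_nonneg _ _ _)
  have hPm := measurable_poisson μ ε
  have hint := fun n => measurable_integral_exp_mul μ (hf n)
  have hl : ∀ t : ℝ, ENNReal.ofReal (ε * (Real.exp (-ε * t) *
        ∑ n ∈ s, c n * ‖∫ x, Complex.exp (-Complex.I * t * x) * f n x ∂μ‖ ^ 2))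
      = ∑ n ∈ s, ENNReal.ofReal (c n) * ENNReal.ofReal (ε * (Real.exp (-ε * t) *
          ‖∫ x, Complex.exp (-Complex.I * t * x) * f n x ∂μ‖ ^ 2)) := by
    intro t
    rw [Finset.mul_sum, Finset.mul_sum, ENNReal.ofReal_sum_of_nonneg fun n _ =>
      mul_nonneg hε.le (mul_nonneg (Real.exp_nonneg _) (mul_nonneg (hc n) (sq_nonneg _)))]
    refine Finset.sum_congr rfl fun n _ => ?_
    rw [← ENNReal.ofReal_mul (hc n)]
    congr 1; ring
  have hr : ∀ E : ℝ, ENNReal.ofReal ((∑ n ∈ s, c n * f n E ^ 2) * (ε ^ 2 * poisson μ ε E))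
      = ∑ n ∈ s, ENNReal.ofReal (c n) *
          ENNReal.ofReal (f n E ^ 2 * (ε ^ 2 * poisson μ ε E)) := by
    intro E
    rw [Finset.sum_mul, ENNReal.ofReal_sum_of_nonneg fun n _ =>
      mul_nonneg (mul_nonneg (hc n) (sq_nonneg _)) (hP E)]
    refine Finset.sum_congr rfl fun n _ => ?_
    rw [← ENNReal.ofReal_mul (hc n), mul_assoc]
  simp only [hl, hr]
  rw [lintegral_finsetSum _ fun n _ => by fun_prop, lintegral_finsetSum _ fun n _ => by fun_prop]
  refine Finset.sum_le_sum fun n _ => ?_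
  rw [lintegral_const_mul' _ _ ENNReal.ofReal_ne_top, lintegral_const_mul' _ _ ENNReal.ofReal_ne_top]
  obtain ⟨M, hM⟩ := hM n
  exact mul_le_mul_right (lintegral_exp_mul_norm_integral_sq_le μ (hf n) hM hε) _

theorem timeAverage_eq (A : ℝ → ℝ) {T : ℝ} (hT : 0 < T) :
    timeAverage A T = ∫⁻ t in Set.Ioi (0 : ℝ),
      ENNReal.ofReal (2 / T * (Real.exp (-(2 / T) * t) * A t)) := by
  rw [timeAverage, ← lintegral_const_mul' _ _ ENNReal.ofReal_ne_top]
  refine lintegral_congr fun t => ?_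
  rw [← ENNReal.ofReal_mul (by positivity), show -2 * t / T = -(2 / T) * t by ring]

section Evolution

variable {a b : ℕ → ℝ}

/-- The evolved packet is `f(H) δ_1` with `f = e^{-itx} 1_S`, and boundedness of `S` gives `f`
bounded support, as the eigenfunction expansion requires. -/
theorem zeroExtend_evolution_eq_integral
    (hH : IsBorelFunctionalCalculus (jacobiOperator a b) (borelCalculus (jacobiOperator a b)))
    (ha : ∀ n, a n ≠ 0) {S : Set ℝ} (hS : MeasurableSet S) {R : ℝ}
    (hR : S ⊆ Set.Icc (-R) R) (t : ℝ) (n : ℕ) :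
    zeroExtend (evolution (jacobiOperator a b) t
        (spectralProjection (jacobiOperator a b) S deltaOne) : HalfLine) n
      = ∫ x, Complex.exp (-Complex.I * t * x) * (S.indicator (fun E => solution a b 0 E n) x : ℝ)
          ∂spectralMeasure (jacobiOperator a b) deltaOne := by
  have hSb : IsBoundedBorel (S.indicator fun _ => 1) := isBoundedBorel_indicator hS
  have hb := (isBoundedBorel_exp t).mul hSb
  have h := zeroExtend_borelCalculus_eq_integral hH ha (R := R) hb (fun x hx => by
    rw [Set.indicator_of_notMem, mul_zero]
    exact fun hxS => hx.not_ge (abs_le.2 (hR hxS))) n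
  rw [hH.map_mul _ _ (isBoundedBorel_exp t) hSb, mul_apply_eq_comp] at h
  refine h.trans (integral_congr_ae (ae_of_all _ fun x => ?_))
  by_cases hx : x ∈ S
  · simp [hx, mul_comm]
  · simp [hx]

theorem abs_indicator_solution_le {S : Set ℝ} {R : ℝ} (hR : S ⊆ Set.Icc (-R) R) (n : ℕ) :
    ∃ M, ∀ x, |S.indicator (fun E => solution a b 0 E n) x| ≤ M := by
  obtain ⟨M, hM⟩ := (isCompact_Icc (a := -R) (b := R)).exists_bound_of_continuousOn
    (continuous_solution a b 0 n).continuousOn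
  refine ⟨max M 0, fun x => ?_⟩
  by_cases hx : x ∈ S
  · rw [Set.indicator_of_mem hx]
    exact (hM x (hR hx)).trans (le_max_left _ _)
  · rw [Set.indicator_of_notMem hx, abs_zero]
    exact le_max_right _ _

theorem measurable_normSqUpTo_evolution
    (hH : IsBorelFunctionalCalculus (jacobiOperator a b) (borelCalculus (jacobiOperator a b)))
    (ha : ∀ n, a n ≠ 0) {S : Set ℝ} (hS : MeasurableSet S) {R : ℝ} (hR : S ⊆ Set.Icc (-R) R)
    {L : ℝ} (hL : 0 ≤ L) :
    Measurable fun t => normSqUpTo (zeroExtend (evolution (jacobiOperator a b) t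
      (spectralProjection (jacobiOperator a b) S deltaOne) : HalfLine)) L := by
  simp only [normSqUpTo_eq_sum _ hL (Nat.le_ceil L), zeroExtend_evolution_eq_integral hH ha hS hR]
  have := fun n => measurable_integral_exp_mul (spectralMeasure (jacobiOperator a b) deltaOne)
    ((continuous_solution a b 0 n).measurable.indicator hS)
  fun_prop

theorem timeAverage_le_of_bounded
    (hH : IsBorelFunctionalCalculus (jacobiOperator a b) (borelCalculus (jacobiOperator a b)))
    (ha : ∀ n, a n ≠ 0) (ha0 : a 0 = 1) (hsum : ¬ Summable fun n => |a n|⁻¹)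
    {S : Set ℝ} (hS : MeasurableSet S) {R : ℝ} (hR : S ⊆ Set.Icc (-R) R)
    {T L : ℝ} (hT : 0 < T) (hL : 0 ≤ L) :
    timeAverage (fun t => normSqUpTo (zeroExtend (evolution (jacobiOperator a b) t
        (spectralProjection (jacobiOperator a b) S deltaOne) : HalfLine)) L) T
      ≤ ENNReal.ofReal 9 * ∫⁻ E in S, ENNReal.ofReal (normSqUpTo (solution a b 0 E) L /
          normSqUpTo (solution a b 0 E) (lengthScale a b T⁻¹ E))
        ∂(spectralMeasure (jacobiOperator a b) deltaOne) := by
  have hε : 0 < 2 / T := by positivity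
  rw [timeAverage_eq _ hT]
  simp only [normSqUpTo_eq_sum (zeroExtend _) hL (Nat.le_ceil L),
    zeroExtend_evolution_eq_integral hH ha hS hR]
  refine (lintegral_sum_weight_mul_le _ _ (siteWeight_nonneg L)
    (fun n => (continuous_solution a b 0 n).measurable.indicator hS)
    (abs_indicator_solution_le hR) hε).trans ?_
  rw [← lintegral_const_mul' _ _ ENNReal.ofReal_ne_top, ← lintegral_indicator hS]
  refine lintegral_mono fun E => ?_
  by_cases hE : E ∈ S
  · simp only [Set.indicator_of_mem hE]
    rw [← ENNReal.ofReal_mul (by norm_num)]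
    refine ENNReal.ofReal_le_ofReal ?_
    have hsumeq : ∑ n ∈ Finset.Icc 1 ⌈L⌉₊, siteWeight L n * solution a b 0 E n ^ 2
        = normSqUpTo (solution a b 0 E) L := by
      rw [normSqUpTo_eq_sum _ hL (Nat.le_ceil L)]
      simp
    rw [hsumeq]
    obtain ⟨h0, h1⟩ := lengthScale_spec a b ha ha0 hsum (inv_pos.2 hT) E
    have hpos := normSqUpTo_lengthScale_pos a b ha ha0 hsum (inv_pos.2 hT) E
    have h := sq_mul_poisson_mul_normSqUpTo_le hH ha ha0 E hε h0
    -- The Poisson scale is `2/T`, whereas the length belongs to `1/T`, where the scale product is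
    -- `T`. Their product is `2`, which gives `(1 + 2)² = 9`.
    rw [h1, inv_inv, div_mul_cancel₀ _ hT.ne'] at h
    norm_num at h
    have h' := (le_div_iff₀ hpos).2 h
    calc _ ≤ _ := mul_le_mul_of_nonneg_left h' (normSqUpTo_nonneg _ hL)
      _ = _ := by ring
  · simp [hE]

theorem tendsto_normSqUpTo_evolution
    (hH : IsBorelFunctionalCalculus (jacobiOperator a b) (borelCalculus (jacobiOperator a b)))
    {S : Set ℝ} (hS : MeasurableSet S) (t : ℝ) {L : ℝ} (hL : 0 ≤ L) :
    Tendsto (fun k : ℕ => normSqUpTo (zeroExtend (evolution (jacobiOperator a b) t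
        (spectralProjection (jacobiOperator a b) (S ∩ Set.Icc (-(k : ℝ)) k) deltaOne) : HalfLine))
        L) atTop
      (𝓝 (normSqUpTo (zeroExtend (evolution (jacobiOperator a b) t
        (spectralProjection (jacobiOperator a b) S deltaOne) : HalfLine)) L)) := by
  have h := hH.tendsto_of_bounded
    (fun k : ℕ => (S ∩ Set.Icc (-(k : ℝ)) k).indicator fun _ => 1) (S.indicator fun _ => 1) 1
    (fun k => (isBoundedBorel_indicator (hS.inter measurableSet_Icc)).1)
    (isBoundedBorel_indicator hS).1
    (fun k x => (norm_indicator_le_norm_self _ _).trans (by simp))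
    (fun x => by
      refine tendsto_const_nhds.congr' ?_
      filter_upwards [eventually_ge_atTop ⌈|x|⌉₊] with k hk
      have hx : x ∈ Set.Icc (-(k : ℝ)) k :=
        abs_le.1 ((Nat.le_ceil _).trans (by exact_mod_cast hk))
      by_cases hxS : x ∈ S
      · rw [Set.indicator_of_mem hxS, Set.indicator_of_mem (Set.mem_inter hxS hx)]
      · rw [Set.indicator_of_notMem hxS, Set.indicator_of_notMem fun h => hxS h.1]) deltaOne
  have h' := ((evolution (jacobiOperator a b) t).continuous.tendsto _).comp h
  have hcoord : ∀ n, Tendsto (fun k : ℕ => zeroExtend (evolution (jacobiOperator a b) t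
      (spectralProjection (jacobiOperator a b) (S ∩ Set.Icc (-(k : ℝ)) k) deltaOne) : HalfLine) n)
      atTop (𝓝 (zeroExtend (evolution (jacobiOperator a b) t
        (spectralProjection (jacobiOperator a b) S deltaOne) : HalfLine) n)) := by
    intro n
    simp only [← inner_unitVector]
    exact tendsto_const_nhds.inner h'
  simp only [normSqUpTo_eq_sum _ hL (Nat.le_ceil L)]
  exact tendsto_finsetSum _ fun n _ => ((hcoord n).norm.pow 2).const_mul _

/-- Replace `S` by `S ∩ [-k, k]`: the right side only grows with the set of integration, and the
left side passes to the limit by Fatou, since the truncated packets converge strongly at each time.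
-/
theorem timeAverage_le
    (hH : IsBorelFunctionalCalculus (jacobiOperator a b) (borelCalculus (jacobiOperator a b)))
    (ha : ∀ n, a n ≠ 0) (ha0 : a 0 = 1) (hsum : ¬ Summable fun n => |a n|⁻¹)
    {S : Set ℝ} (hS : MeasurableSet S) {T L : ℝ} (hT : 0 < T) (hL : 0 ≤ L) :
    timeAverage (fun t => normSqUpTo (zeroExtend (evolution (jacobiOperator a b) t
        (spectralProjection (jacobiOperator a b) S deltaOne) : HalfLine)) L) T
      ≤ ENNReal.ofReal 9 * ∫⁻ E in S, ENNReal.ofReal (normSqUpTo (solution a b 0 E) L /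
          normSqUpTo (solution a b 0 E) (lengthScale a b T⁻¹ E))
        ∂(spectralMeasure (jacobiOperator a b) deltaOne) := by
  have hSk : ∀ k : ℕ, MeasurableSet (S ∩ Set.Icc (-(k : ℝ)) k) := fun k =>
    hS.inter measurableSet_Icc
  have hk : ∀ k : ℕ, timeAverage (fun t => normSqUpTo (zeroExtend
        (evolution (jacobiOperator a b) t (spectralProjection (jacobiOperator a b)
          (S ∩ Set.Icc (-(k : ℝ)) k) deltaOne) : HalfLine)) L) T
      ≤ ENNReal.ofReal 9 * ∫⁻ E in S, ENNReal.ofReal (normSqUpTo (solution a b 0 E) L /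
          normSqUpTo (solution a b 0 E) (lengthScale a b T⁻¹ E))
        ∂(spectralMeasure (jacobiOperator a b) deltaOne) := fun k =>
    (timeAverage_le_of_bounded hH ha ha0 hsum (hSk k) Set.inter_subset_right hT hL).trans
      (mul_le_mul_right (lintegral_mono_set Set.inter_subset_left) _)
  rw [timeAverage_eq _ hT]
  simp only [timeAverage_eq _ hT] at hk
  have hlim : ∀ t, ENNReal.ofReal (2 / T * (Real.exp (-(2 / T) * t) *
      normSqUpTo (zeroExtend (evolution (jacobiOperator a b) t
        (spectralProjection (jacobiOperator a b) S deltaOne) : HalfLine)) L))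
      = liminf (fun k : ℕ => ENNReal.ofReal (2 / T * (Real.exp (-(2 / T) * t) *
        normSqUpTo (zeroExtend (evolution (jacobiOperator a b) t
          (spectralProjection (jacobiOperator a b) (S ∩ Set.Icc (-(k : ℝ)) k) deltaOne) :
            HalfLine)) L))) atTop := fun t =>
    (ENNReal.tendsto_ofReal
      (((tendsto_normSqUpTo_evolution hH hS t hL).const_mul _).const_mul _)).liminf_eq.symm
  simp only [hlim]
  refine (lintegral_liminf_le fun k => ?_).trans ?_
  · have := measurable_normSqUpTo_evolution hH ha (hSk k) Set.inter_subset_right hL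
    fun_prop
  · exact (liminf_le_liminf (Eventually.of_forall hk)).trans_eq (liminf_const _)

end Evolution

/-! ### Carleman's criterion -/

/-- Green's formula. -/
theorem im_mul_sum_norm_sq_eq (a b : ℕ → ℝ) (z : ℂ) (φ : ℕ → ℂ) (h0 : φ 0 = 0)
    (hφ : ∀ n, a (n + 1) * φ (n + 2) + a n * φ n + b (n + 1) * φ (n + 1) = z * φ (n + 1)) (N : ℕ) :
    z.im * ∑ n ∈ Finset.Icc 1 N, ‖φ n‖ ^ 2
      = a N * (φ (N + 1) * (starRingEnd ℂ) (φ N)).im := by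
  induction N with
  | zero => simp [h0]
  | succ N ih =>
    rw [Finset.sum_Icc_succ_top (by omega), mul_add, ih]
    have h := congrArg (fun w => (w * (starRingEnd ℂ) (φ (N + 1))).im) (hφ N)
    simp only [add_mul, Complex.add_im, mul_assoc, Complex.mul_conj, Complex.im_ofReal_mul,
      Complex.im_mul_ofReal, Complex.ofReal_im] at h
    rw [Complex.sq_norm, ← h]
    simp only [Complex.mul_im, Complex.conj_re, Complex.conj_im]
    ring

/-- Under Carleman's condition there are no square summable solutions at nonreal energies. -/
theorem eq_zero_of_summable_norm_sq {a b : ℕ → ℝ} (ha : ∀ n, a n ≠ 0)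
    (hsum : ¬ Summable fun n => |a n|⁻¹) {z : ℂ} (hz : z.im ≠ 0) {φ : ℕ → ℂ} (h0 : φ 0 = 0)
    (hφ : ∀ n, a (n + 1) * φ (n + 2) + a n * φ n + b (n + 1) * φ (n + 1) = z * φ (n + 1))
    (hs : Summable fun n => ‖φ n‖ ^ 2) (n : ℕ) : φ n = 0 := by
  have h1 : φ 1 = 0 := by
    by_contra h1
    apply hsum
    rw [← summable_nat_add_iff 1]
    set κ := |z.im| * ‖φ 1‖ ^ 2
    have hκ : 0 < κ := by positivity
    -- By Green's formula the flux `|a(n)| |φ(n+1)| |φ(n)|`, `n ≥ 1`, stays above `|Im z| |φ(1)|²`;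
    -- hence `1/|a(n)|` is dominated by a summable sequence, unless `φ(1) = 0`.
    have hbd : ∀ n, |a (n + 1)|⁻¹ ≤ κ⁻¹ * (‖φ (n + 2)‖ ^ 2 + ‖φ (n + 1)‖ ^ 2) := by
      intro n
      have hle : κ ≤ |a (n + 1)| * (‖φ (n + 2)‖ * ‖φ (n + 1)‖) := by
        calc κ ≤ |z.im| * ∑ k ∈ Finset.Icc 1 (n + 1), ‖φ k‖ ^ 2 := by
              refine mul_le_mul_of_nonneg_left ?_ (abs_nonneg _)
              exact Finset.single_le_sum (f := fun k => ‖φ k‖ ^ 2) (fun k _ => sq_nonneg _)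
                (Finset.mem_Icc.2 ⟨le_rfl, by omega⟩)
          _ = |z.im * ∑ k ∈ Finset.Icc 1 (n + 1), ‖φ k‖ ^ 2| := by
              rw [abs_mul, abs_of_nonneg (Finset.sum_nonneg fun k _ => sq_nonneg ‖φ k‖)]
          _ = |a (n + 1)| * |(φ (n + 2) * (starRingEnd ℂ) (φ (n + 1))).im| := by
              rw [im_mul_sum_norm_sq_eq a b z φ h0 hφ, abs_mul]
          _ ≤ |a (n + 1)| * (‖φ (n + 2)‖ * ‖φ (n + 1)‖) := by
              refine mul_le_mul_of_nonneg_left ?_ (abs_nonneg _)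
              refine (Complex.abs_im_le_norm _).trans ?_
              rw [norm_mul, RCLike.norm_conj]
      have ha' : 0 < |a (n + 1)| := abs_pos.2 (ha _)
      rw [inv_mul_eq_div, le_div_iff₀ hκ, inv_mul_le_iff₀ ha']
      refine hle.trans (mul_le_mul_of_nonneg_left ?_ ha'.le)
      nlinarith [sq_nonneg (‖φ (n + 2)‖ - ‖φ (n + 1)‖), sq_nonneg ‖φ (n + 2)‖,
        sq_nonneg ‖φ (n + 1)‖]
    refine Summable.of_nonneg_of_le (fun n => by positivity) hbd (Summable.mul_left _ ?_)
    exact ((summable_nat_add_iff 2).2 hs).add ((summable_nat_add_iff 1).2 hs)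
  induction n using Nat.twoStepInduction with
  | zero => exact h0
  | one => exact h1
  | more n h2 h3 =>
    have h := hφ n
    rw [h2, h3] at h
    have ha' : (a (n + 1) : ℂ) ≠ 0 := by exact_mod_cast ha (n + 1)
    simpa [ha'] using h

/-! ### Truncated Jacobi matrices -/

/-- The entry of the Jacobi matrix in row `i + 1` and column `k + 1`. -/
noncomputable def jacobiEntry (a b : ℕ → ℝ) (i k : ℕ) : ℝ :=
  (if k = i + 1 then a k else 0) + (if i = k + 1 then a i else 0) + if k = i then b (k + 1) else 0

/-- The last row is excluded because truncation drops its term `a(N) y(N+1)`; the remaining rows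
still determine an eigenvector from its first entry. -/
theorem sum_jacobiEntry_mul (a b : ℕ → ℝ) {y : ℕ → ℝ} (hy : y 0 = 0) {N i : ℕ}
    (hi : i + 1 < N) :
    ∑ k ∈ Finset.range N, jacobiEntry a b i k * y (k + 1)
      = a (i + 1) * y (i + 2) + a i * y i + b (i + 1) * y (i + 1) := by
  simp only [jacobiEntry, add_mul, Finset.sum_add_distrib, ite_mul, zero_mul]
  rw [Finset.sum_ite_eq', Finset.sum_ite_eq', if_pos (Finset.mem_range.2 hi),
    if_pos (Finset.mem_range.2 (by omega))]
  congr 2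
  rcases i with _ | i
  · simp [hy]
  · have : ∀ k, (i + 1 = k + 1) = (i = k) := fun k => by simp
    simp only [this]
    rw [Finset.sum_ite_eq, if_pos (Finset.mem_range.2 (by omega))]

theorem eq_mul_solution (a b : ℕ → ℝ) (ha : ∀ n, a n ≠ 0) {E : ℝ} {y : ℕ → ℝ} (hy : y 0 = 0)
    {N : ℕ} (h : ∀ i, i + 1 < N →
      a (i + 1) * y (i + 2) + a i * y i + b (i + 1) * y (i + 1) = E * y (i + 1))
    (n : ℕ) (hn : n ≤ N) : y n = y 1 * solution a b 0 E n := by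
  induction n using Nat.twoStepInduction with
  | zero => simp [hy, solution]
  | one => simp [solution]
  | more n h0 h1 =>
    apply mul_left_cancel₀ (ha (n + 1))
    linear_combination h n (by omega) - y 1 * solution_add_two a b ha 0 E n
      - a n * h0 (by omega) + (E - b (n + 1)) * h1 (by omega)

/-- Gaussian quadrature: the spectral data of the truncated Jacobi matrix. -/
theorem exists_quadrature (a b : ℕ → ℝ) (ha : ∀ n, a n ≠ 0) (N : ℕ) :
    ∃ w x : Fin N → ℝ, (∀ j, 0 ≤ w j) ∧ ∀ n ∈ Finset.Icc 1 N, ∀ m ∈ Finset.Icc 1 N,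
      ∑ j, w j * (solution a b 0 (x j) n * solution a b 0 (x j) m) = if n = m then 1 else 0 := by
  set J : Matrix (Fin N) (Fin N) ℝ := Matrix.of fun i k => jacobiEntry a b i k
  have hJ : J.IsHermitian := by
    ext i k
    simp only [J, Matrix.conjTranspose_apply, Matrix.of_apply, star_trivial, jacobiEntry]
    rw [add_comm (if (i : ℕ) = k + 1 then a i else 0)]
    congr 1
    rcases eq_or_ne (i : ℕ) k with h | h
    · simp [h]
    · simp [h, h.symm]
  set U : Matrix (Fin N) (Fin N) ℝ := hJ.eigenvectorUnitary.1
  set x := hJ.eigenvalues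
  set y : Fin N → ℕ → ℝ := fun j n =>
    if h : 0 < n ∧ n - 1 < N then U ⟨n - 1, h.2⟩ j else 0
  have hyU : ∀ (j i : Fin N), y j (i + 1) = U i j := fun j i => by simp [y]
  have hy0 : ∀ j, y j 0 = 0 := fun j => by simp [y]
  have heig : ∀ j, ∀ i, i + 1 < N → a (i + 1) * y j (i + 2) + a i * y j i
      + b (i + 1) * y j (i + 1) = x j * y j (i + 1) := by
    intro j i hi
    have h := congrFun (hJ.mulVec_eigenvectorBasis j) ⟨i, by omega⟩
    simp only [Matrix.mulVec, dotProduct, Pi.smul_apply, smul_eq_mul] at h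
    rw [← sum_jacobiEntry_mul a b (hy0 j) hi,
      ← Fin.sum_univ_eq_sum_range fun k => jacobiEntry a b i k * y j (k + 1)]
    simp only [hyU]
    rw [show y j (i + 1) = U ⟨i, by omega⟩ j from hyU j ⟨i, by omega⟩]
    exact h
  have horth : ∀ i k : Fin N, ∑ j, U i j * U k j = if i = k then 1 else 0 := by
    intro i k
    have hU : U * star U = 1 := Unitary.mul_star_self_of_mem hJ.eigenvectorUnitary.2
    have h := congrArg (fun M : Matrix (Fin N) (Fin N) ℝ => M i k) hU
    simpa only [Matrix.mul_apply, Matrix.star_apply, star_trivial, Matrix.one_apply] using h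
  -- Each normalized eigenvector is its first component times `u_0(·, x_j)`. With squared first
  -- components as weights, orthonormality of the rows of the eigenvector matrix is discrete
  -- orthogonality of the `u_0(n, ·)`.
  refine ⟨fun j => y j 1 ^ 2, x, fun j => sq_nonneg _, fun n hn m hm => ?_⟩
  obtain ⟨hn1, hnN⟩ := Finset.mem_Icc.1 hn
  obtain ⟨hm1, hmN⟩ := Finset.mem_Icc.1 hm
  obtain ⟨i, rfl⟩ : ∃ i, n = i + 1 := ⟨n - 1, by omega⟩
  obtain ⟨k, rfl⟩ : ∃ k, m = k + 1 := ⟨m - 1, by omega⟩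
  have h := horth ⟨i, by omega⟩ ⟨k, by omega⟩
  simp only [Fin.mk.injEq] at h
  simp only [Nat.add_right_cancel_iff, ← h]
  refine Finset.sum_congr rfl fun j _ => ?_
  rw [show U ⟨i, by omega⟩ j = y j (i + 1) from (hyU j ⟨i, by omega⟩).symm,
    show U ⟨k, by omega⟩ j = y j (k + 1) from (hyU j ⟨k, by omega⟩).symm,
    eq_mul_solution a b ha (hy0 j) (heig j) _ hnN, eq_mul_solution a b ha (hy0 j) (heig j) _ hmN]
  ring

/-! ### The orthogonality measure -/

theorem exists_isProbabilityMeasure_quadrature (a b : ℕ → ℝ) (ha : ∀ n, a n ≠ 0) {N : ℕ}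
    (hN : 1 ≤ N) :
    ∃ ν : Measure ℝ, IsProbabilityMeasure ν ∧ (∀ g : ℝ → ℝ, Integrable g ν) ∧
      ∀ n ∈ Finset.Icc 1 N, ∀ m ∈ Finset.Icc 1 N,
        ∫ x, solution a b 0 x n * solution a b 0 x m ∂ν = if n = m then 1 else 0 := by
  obtain ⟨w, x, hw, h⟩ := exists_quadrature a b ha N
  have hint : ∀ (g : ℝ → ℝ) (j : Fin N), Integrable g (ENNReal.ofReal (w j) • Measure.dirac (x j)) :=
    fun g j => (integrable_dirac (by simp)).smul_measure ENNReal.ofReal_ne_top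
  refine ⟨∑ j, ENNReal.ofReal (w j) • Measure.dirac (x j), ⟨?_⟩,
    fun g => integrable_finsetSum_measure.2 fun j _ => hint g j, fun n hn m hm => ?_⟩
  -- The total mass is the case `n = m = 1`, since `u_0(1, ·) = 1`.
  · have h1 := h 1 (by simp [hN]) 1 (by simp [hN])
    simp only [solution, Real.cos_zero, mul_one, if_true] at h1
    simp only [Measure.finsetSum_apply, Measure.smul_apply, measure_univ, smul_eq_mul, mul_one]
    rw [← ENNReal.ofReal_sum_of_nonneg fun j _ => hw j, h1, ENNReal.ofReal_one]
  · rw [integral_finsetSum_measure fun j _ => hint _ j, ← h n hn m hm]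
    refine Finset.sum_congr rfl fun j _ => ?_
    rw [integral_smul_measure, integral_dirac, ENNReal.toReal_ofReal (hw j), smul_eq_mul]

theorem mul_solution_eq (a b : ℕ → ℝ) (ha : ∀ n, a n ≠ 0) (x : ℝ) (n : ℕ) :
    x * solution a b 0 x (n + 1) = a (n + 1) * solution a b 0 x (n + 2)
      + a n * solution a b 0 x n + b (n + 1) * solution a b 0 x (n + 1) := by
  linear_combination -solution_add_two a b ha 0 x n

/-- The recurrence expresses `x u_{n+1}` by three polynomials of norm at most one, so the bound does
not depend on `N`. It controls the tails of all quadrature measures at once; `n + 2 ≤ N` is needed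
because multiplication by `x` raises the index by one. -/
theorem integral_mul_solution_sq_le (a b : ℕ → ℝ) (ha : ∀ n, a n ≠ 0) {ν : Measure ℝ}
    (hint : ∀ g : ℝ → ℝ, Integrable g ν) {N : ℕ}
    (h : ∀ n ∈ Finset.Icc 1 N, ∀ m ∈ Finset.Icc 1 N,
      ∫ x, solution a b 0 x n * solution a b 0 x m ∂ν = if n = m then 1 else 0)
    {n : ℕ} (hn : n + 2 ≤ N) :
    ∫ x, (x * solution a b 0 x (n + 1)) ^ 2 ∂ν
      ≤ 3 * (a (n + 1) ^ 2 + a n ^ 2 + b (n + 1) ^ 2) := by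
  have hsq : ∀ k ≤ N, ∫ x, solution a b 0 x k ^ 2 ∂ν ≤ 1 := by
    intro k hk
    rcases Nat.eq_zero_or_pos k with rfl | hk0
    · simp [solution]
    · have := h k (by simp; omega) k (by simp; omega)
      simp only [← sq, if_true] at this
      exact this.le
  calc ∫ x, (x * solution a b 0 x (n + 1)) ^ 2 ∂ν
      ≤ ∫ x, (3 * a (n + 1) ^ 2) * solution a b 0 x (n + 2) ^ 2
        + ((3 * a n ^ 2) * solution a b 0 x n ^ 2
        + (3 * b (n + 1) ^ 2) * solution a b 0 x (n + 1) ^ 2) ∂ν := by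
        refine integral_mono (hint _) (hint _) fun x => ?_
        beta_reduce
        rw [mul_solution_eq a b ha]
        set p := a (n + 1) * solution a b 0 x (n + 2) with hp
        set q := a n * solution a b 0 x n with hq
        set r := b (n + 1) * solution a b 0 x (n + 1) with hr
        have : (3 * a (n + 1) ^ 2) * solution a b 0 x (n + 2) ^ 2
          + ((3 * a n ^ 2) * solution a b 0 x n ^ 2
          + (3 * b (n + 1) ^ 2) * solution a b 0 x (n + 1) ^ 2)
          = 3 * (p ^ 2 + q ^ 2 + r ^ 2) := by rw [hp, hq, hr]; ring
        rw [this]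
        nlinarith [sq_nonneg (p - q), sq_nonneg (p - r), sq_nonneg (q - r)]
    _ = (3 * a (n + 1) ^ 2) * ∫ x, solution a b 0 x (n + 2) ^ 2 ∂ν
        + ((3 * a n ^ 2) * ∫ x, solution a b 0 x n ^ 2 ∂ν
        + (3 * b (n + 1) ^ 2) * ∫ x, solution a b 0 x (n + 1) ^ 2 ∂ν) := by
        rw [integral_add (hint _) (hint _), integral_add (hint _) (hint _), integral_const_mul,
          integral_const_mul, integral_const_mul]
    _ ≤ (3 * a (n + 1) ^ 2) * 1 + ((3 * a n ^ 2) * 1 + (3 * b (n + 1) ^ 2) * 1) := by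
        gcongr
        · exact hsq _ hn
        · exact hsq _ (by omega)
        · exact hsq _ (by omega)
    _ = _ := by ring

/-- A continuous cutoff, equal to `1` on `[-R, R]` and supported in `[-R - 1, R + 1]`. -/
noncomputable def cutoff (R x : ℝ) : ℝ := max 0 (min 1 (R + 1 - |x|))

theorem continuous_cutoff (R : ℝ) : Continuous (cutoff R) := by unfold cutoff; fun_prop

theorem cutoff_nonneg (R x : ℝ) : 0 ≤ cutoff R x := le_max_left _ _

theorem cutoff_le_one (R x : ℝ) : cutoff R x ≤ 1 := max_le zero_le_one (min_le_left _ _)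

theorem cutoff_eq_one {R x : ℝ} (h : |x| ≤ R) : cutoff R x = 1 := by
  rw [cutoff, min_eq_left (by linarith), max_eq_right zero_le_one]

theorem one_sub_cutoff_le {R : ℝ} (hR : 0 < R) (x : ℝ) : 1 - cutoff R x ≤ |x| / R := by
  rcases le_total |x| R with h | h
  · rw [cutoff_eq_one h, sub_self]; positivity
  · have : 1 ≤ |x| / R := (one_le_div hR).2 h
    linarith [cutoff_nonneg R x]

theorem tendsto_cutoff (x : ℝ) : Tendsto (fun k : ℕ => cutoff k x) atTop (𝓝 1) := by
  refine tendsto_const_nhds.congr' ?_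
  filter_upwards [eventually_ge_atTop ⌈|x|⌉₊] with k hk
  rw [cutoff_eq_one ((Nat.le_ceil _).trans (by exact_mod_cast hk))]

theorem exists_bound_cutoff_mul {g : ℝ → ℝ} (hg : Continuous g) (R : ℝ) :
    ∃ C, ∀ x, ‖cutoff R x * g x‖ ≤ C := by
  refine HasCompactSupport.exists_bound_of_continuous ?_ ((continuous_cutoff R).mul hg)
  refine HasCompactSupport.intro (isCompact_Icc (a := -(R + 1)) (b := R + 1)) fun x hx => ?_
  have : R + 1 < |x| := not_le.1 fun h => hx (abs_le.1 h)
  rw [cutoff, min_eq_right (by linarith), max_eq_left (by linarith), zero_mul]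

/-- The cutoff loses at most `|x|/R`, and `x u_{n+1}` has a second moment bounded uniformly in `N`.
The error is therefore `O(1/R)` uniformly, and orthogonality of unbounded polynomials survives a
weak limit. -/
theorem abs_integral_cutoff_mul_sub_le (a b : ℕ → ℝ) (ha : ∀ n, a n ≠ 0) {ν : Measure ℝ}
    (hint : ∀ g : ℝ → ℝ, Integrable g ν) {N : ℕ}
    (h : ∀ n ∈ Finset.Icc 1 N, ∀ m ∈ Finset.Icc 1 N,
      ∫ x, solution a b 0 x n * solution a b 0 x m ∂ν = if n = m then 1 else 0)
    {n m : ℕ} (hn : n + 2 ≤ N) (hm : m + 1 ≤ N) {R : ℝ} (hR : 0 < R) :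
    |∫ x, cutoff R x * (solution a b 0 x (n + 1) * solution a b 0 x (m + 1)) ∂ν
        - if n + 1 = m + 1 then 1 else 0|
      ≤ (3 * (a (n + 1) ^ 2 + a n ^ 2 + b (n + 1) ^ 2) + 1) / R := by
  have hnm := h (n + 1) (by simp; omega) (m + 1) (by simp; omega)
  have hmm := h (m + 1) (by simp; omega) (m + 1) (by simp; omega)
  rw [if_pos rfl] at hmm
  rw [← hnm, ← integral_sub (hint _) (hint _)]
  calc |∫ x, (cutoff R x * (solution a b 0 x (n + 1) * solution a b 0 x (m + 1))
        - solution a b 0 x (n + 1) * solution a b 0 x (m + 1)) ∂ν|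
      ≤ ∫ x, ((x * solution a b 0 x (n + 1)) ^ 2
          + solution a b 0 x (m + 1) * solution a b 0 x (m + 1)) * R⁻¹ ∂ν := by
        refine (abs_integral_le_integral_abs).trans (integral_mono (hint _) (hint _) fun x => ?_)
        beta_reduce
        set p := solution a b 0 x (n + 1)
        set q := solution a b 0 x (m + 1)
        have h1 : |cutoff R x * (p * q) - p * q| = (1 - cutoff R x) * (|p| * |q|) := by
          rw [← abs_mul p q, ← abs_of_nonneg (sub_nonneg.2 (cutoff_le_one R x)), ← abs_mul,
            ← abs_neg]
          congr 1; ring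
        rw [h1]
        calc (1 - cutoff R x) * (|p| * |q|) ≤ |x| / R * (|p| * |q|) := by
              gcongr; exact one_sub_cutoff_le hR x
          _ = (|x * p| * |q|) * R⁻¹ := by rw [abs_mul]; ring
          _ ≤ ((x * p) ^ 2 + q * q) * R⁻¹ := by
              gcongr
              nlinarith [sq_nonneg (|x * p| - |q|), sq_abs (x * p), sq_abs q, sq_nonneg (x * p),
                sq_nonneg q]
    _ ≤ _ := by
        rw [integral_mul_const, integral_add (hint _) (hint _), hmm, div_eq_mul_inv]
        gcongr
        exact integral_mul_solution_sq_le a b ha hint h hn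

theorem isTightMeasureSet_range_quadrature (a b : ℕ → ℝ) (ha : ∀ n, a n ≠ 0) (ν : ℕ → Measure ℝ)
    [∀ k, IsProbabilityMeasure (ν k)] (hint : ∀ k, ∀ g : ℝ → ℝ, Integrable g (ν k))
    (h : ∀ k, ∀ n ∈ Finset.Icc 1 (k + 1), ∀ m ∈ Finset.Icc 1 (k + 1),
      ∫ x, solution a b 0 x n * solution a b 0 x m ∂(ν k) = if n = m then 1 else 0) :
    IsTightMeasureSet (Set.range ν) := by
  apply isTightMeasureSet_range_of_tendsto_limsup_measure_norm_gt
  set C := 3 * (a 1 ^ 2 + a 0 ^ 2 + b 1 ^ 2)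
  have hlim : Tendsto (fun r : ℝ => ENNReal.ofReal (C / r ^ 2)) atTop (𝓝 0) := by
    rw [← ENNReal.ofReal_zero]
    exact ENNReal.tendsto_ofReal (tendsto_const_nhds.div_atTop (tendsto_pow_atTop two_ne_zero))
  refine tendsto_of_tendsto_of_tendsto_of_le_of_le' tendsto_const_nhds hlim
    (Eventually.of_forall fun _ => zero_le) ?_
  filter_upwards [eventually_gt_atTop 0] with r hr
  refine limsup_le_of_le (by isBoundedDefault) ?_
  filter_upwards [eventually_ge_atTop 1] with k hk
  -- For `n = 0` the polynomial is `1`, so this is a uniform second moment for Chebyshev's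
  -- inequality; it needs at least two quadrature nodes, hence `k ≥ 1`.
  have hC := integral_mul_solution_sq_le a b ha (hint k) (h k) (n := 0) (by omega)
  have hm := mul_meas_ge_le_integral_of_nonneg (μ := ν k)
    (f := fun x => (x * solution a b 0 x (0 + 1)) ^ 2) (ae_of_all _ fun x => sq_nonneg _)
    (hint k _) (r ^ 2)
  have hle : (ν k).real {x | r < ‖x‖} ≤ C / r ^ 2 := by
    rw [le_div_iff₀ (by positivity), mul_comm]
    refine le_trans (mul_le_mul_of_nonneg_left (measureReal_mono fun x hx => ?_) (by positivity))
      (hm.trans hC)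
    have hx' : r < |x| := hx
    simp only [solution, Real.cos_zero, mul_one, Set.mem_ofPred_eq]
    rw [← sq_abs x]
    gcongr
  rw [← ofReal_measureReal]
  exact ENNReal.ofReal_le_ofReal hle

/-- **Favard's theorem**: the polynomials `u_n` are orthonormal for some probability measure. -/
theorem exists_orthogonality_measure (a b : ℕ → ℝ) (ha : ∀ n, a n ≠ 0) :
    ∃ μ : Measure ℝ, IsProbabilityMeasure μ ∧
      (∀ n, Integrable (fun x => solution a b 0 x n ^ 2) μ) ∧
      ∀ n m, ∫ x, solution a b 0 x (n + 1) * solution a b 0 x (m + 1) ∂μ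
        = if n = m then 1 else 0 := by
  choose ν hν hint horth using fun k : ℕ =>
    exists_isProbabilityMeasure_quadrature a b ha (N := k + 1) (by omega)
  have htight := isTightMeasureSet_range_quadrature a b ha ν hint horth
  set P : ℕ → ProbabilityMeasure ℝ := fun k => ⟨ν k, hν k⟩
  have hcpt : IsCompact (closure (Set.range P)) := by
    apply isCompact_closure_of_isTightMeasureSet
    convert htight using 1
    ext ρ
    exact ⟨fun ⟨_, ⟨k, hk⟩, h⟩ => ⟨k, by rw [← h, ← hk]; rfl⟩,
      fun ⟨k, hk⟩ => ⟨P k, ⟨k, rfl⟩, hk⟩⟩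
  -- A limit along a free ultrafilter replaces extraction of a subsequence.
  obtain ⟨μ, -, hμ⟩ := hcpt.ultrafilter_le_nhds ((hyperfilter ℕ).map P)
    (le_principal_iff.2 (by
      rw [Ultrafilter.coe_map, mem_map]
      exact Filter.univ_mem' fun k => subset_closure ⟨k, rfl⟩))
  have htend : Tendsto P (hyperfilter ℕ) (𝓝 μ) := hμ
  rw [ProbabilityMeasure.tendsto_iff_forall_integral_tendsto] at htend
  set C : ℕ → ℝ := fun n => 3 * (a (n + 1) ^ 2 + a n ^ 2 + b (n + 1) ^ 2) + 1
  have hC0 : ∀ n, 0 ≤ C n := fun n => by positivity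
  have hucont := continuous_solution a b 0
  have hcut : ∀ n m (R : ℝ), 0 < R →
      |∫ x, cutoff R x * (solution a b 0 x (n + 1) * solution a b 0 x (m + 1)) ∂(μ : Measure ℝ)
        - if n + 1 = m + 1 then 1 else 0| ≤ C n / R := by
    intro n m R hR
    have hc : Continuous fun x => solution a b 0 x (n + 1) * solution a b 0 x (m + 1) :=
      (hucont _).mul (hucont _)
    obtain ⟨M, hM⟩ := exists_bound_cutoff_mul hc R
    have ht := htend (BoundedContinuousFunction.ofNormedAddCommGroup _
      ((continuous_cutoff R).mul hc) M hM)
    simp only [BoundedContinuousFunction.coe_ofNormedAddCommGroup] at ht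
    refine le_of_tendsto (ht.sub_const _).abs ?_
    have hev : ∀ᶠ k in atTop, n + 2 + m ≤ k := eventually_ge_atTop _
    rw [← Nat.cofinite_eq_atTop] at hev
    filter_upwards [hyperfilter_le_cofinite hev] with k hk
    exact abs_integral_cutoff_mul_sub_le a b ha (hint k) (horth k) (by omega) (by omega) hR
  have hsq : ∀ n, Integrable (fun x => solution a b 0 x n ^ 2) (μ : Measure ℝ) := by
    intro n
    rcases n with _ | n
    · simp [solution]
    refine ⟨((hucont _).pow 2).aestronglyMeasurable, ?_⟩
    rw [hasFiniteIntegral_iff_ofReal (ae_of_all _ fun x => sq_nonneg _)]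
    -- Square integrability under the limit measure comes first, by Fatou as the cutoff is removed;
    -- it then supplies the dominating function for the orthogonality relations.
    have hlim : ∀ x, ENNReal.ofReal (solution a b 0 x (n + 1) ^ 2)
        = liminf (fun k : ℕ => ENNReal.ofReal (cutoff k x *
            (solution a b 0 x (n + 1) * solution a b 0 x (n + 1)))) atTop := by
      intro x
      have := ENNReal.tendsto_ofReal ((tendsto_cutoff x).mul_const
        (solution a b 0 x (n + 1) * solution a b 0 x (n + 1)))
      rw [one_mul, ← sq] at this
      rw [← sq]
      exact this.liminf_eq.symm
    simp only [hlim]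
    have hm : ∀ k : ℕ, Measurable fun x => ENNReal.ofReal (cutoff k x *
            (solution a b 0 x (n + 1) * solution a b 0 x (n + 1))) := fun k =>
      ((continuous_cutoff k).mul ((hucont _).mul (hucont _))).measurable.ennreal_ofReal
    refine (lintegral_liminf_le hm).trans_lt ?_
    refine lt_of_le_of_lt (b := ENNReal.ofReal (1 + C n)) ?_ ENNReal.ofReal_lt_top
    refine liminf_le_of_frequently_le' (Eventually.frequently ?_)
    filter_upwards [eventually_ge_atTop 1] with k hk
    have hk1 : (1 : ℝ) ≤ k := by exact_mod_cast hk
    have hk0 : (0 : ℝ) < k := by linarith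
    have hc : Continuous fun x => solution a b 0 x (n + 1) * solution a b 0 x (n + 1) :=
      (hucont _).mul (hucont _)
    obtain ⟨M, hM⟩ := exists_bound_cutoff_mul hc k
    have hi : Integrable (fun x => cutoff k x *
        (solution a b 0 x (n + 1) * solution a b 0 x (n + 1))) (μ : Measure ℝ) :=
      Integrable.of_bound ((continuous_cutoff k).mul hc).aestronglyMeasurable M (ae_of_all _ hM)
    rw [← ofReal_integral_eq_lintegral_ofReal hi
      (ae_of_all _ fun x => mul_nonneg (cutoff_nonneg _ _) (mul_self_nonneg _))]
    refine ENNReal.ofReal_le_ofReal ?_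
    have h := (abs_le.1 (hcut n n k hk0)).2
    rw [if_pos rfl] at h
    have : C n / k ≤ C n := div_le_self (hC0 n) hk1
    linarith
  refine ⟨μ, inferInstance, hsq, fun n m => ?_⟩
  have hlim1 : Tendsto (fun k : ℕ =>
      ∫ x, cutoff k x * (solution a b 0 x (n + 1) * solution a b 0 x (m + 1)) ∂(μ : Measure ℝ))
      atTop (𝓝 (∫ x, solution a b 0 x (n + 1) * solution a b 0 x (m + 1) ∂(μ : Measure ℝ))) := by
    refine tendsto_integral_of_dominated_convergence
      (fun x => solution a b 0 x (n + 1) ^ 2 + solution a b 0 x (m + 1) ^ 2)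
      (fun k => ((continuous_cutoff k).mul ((hucont _).mul (hucont _))).aestronglyMeasurable)
      ((hsq _).add (hsq _)) (fun k => ae_of_all _ fun x => ?_) (ae_of_all _ fun x => ?_)
    · rw [norm_mul, Real.norm_of_nonneg (cutoff_nonneg _ _), norm_mul, Real.norm_eq_abs,
        Real.norm_eq_abs]
      refine (mul_le_of_le_one_left (by positivity) (cutoff_le_one _ _)).trans ?_
      set p := solution a b 0 x (n + 1)
      set q := solution a b 0 x (m + 1)
      nlinarith [sq_nonneg (|p| - |q|), sq_abs p, sq_abs q, sq_nonneg p, sq_nonneg q]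
    · simpa using (tendsto_cutoff x).mul_const
        (solution a b 0 x (n + 1) * solution a b 0 x (m + 1))
  have hlim2 : Tendsto (fun k : ℕ =>
      ∫ x, cutoff k x * (solution a b 0 x (n + 1) * solution a b 0 x (m + 1)) ∂(μ : Measure ℝ))
      atTop (𝓝 (if n + 1 = m + 1 then 1 else 0)) := by
    rw [tendsto_iff_norm_sub_tendsto_zero]
    have hz : Tendsto (fun k : ℕ => C n / (k : ℝ)) atTop (𝓝 0) :=
      tendsto_const_nhds.div_atTop tendsto_natCast_atTop_atTop
    refine tendsto_of_tendsto_of_tendsto_of_le_of_le' tendsto_const_nhds hz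
      (Eventually.of_forall fun _ => norm_nonneg _) ?_
    filter_upwards [eventually_gt_atTop 0] with k hk
    exact hcut n m k (by exact_mod_cast hk)
  rw [tendsto_nhds_unique hlim1 hlim2]
  simp

/-! ### Completeness of the orthogonal polynomials -/

section Completeness

variable {μ : Measure ℝ}

theorem IsBoundedBorel.memLp_mul {f g : ℝ → ℂ} (hf : IsBoundedBorel f) (hg : MemLp g 2 μ) :
    MemLp (fun x => f x * g x) 2 μ := by
  obtain ⟨hfm, M, hM⟩ := hf
  refine hg.of_le_mul (c := M) (hfm.aestronglyMeasurable.mul hg.1) (ae_of_all _ fun x => ?_)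
  rw [norm_mul]
  exact mul_le_mul_of_nonneg_right (hM x) (norm_nonneg _)

theorem memLp_solution {a b : ℕ → ℝ} {n : ℕ}
    (h : Integrable (fun x => solution a b 0 x n ^ 2) μ) :
    MemLp (fun x => (solution a b 0 x n : ℂ)) 2 μ := by
  have hc : Continuous fun x => (solution a b 0 x n : ℂ) :=
    Complex.continuous_ofReal.comp (continuous_solution a b 0 n)
  rw [memLp_two_iff_integrable_sq_norm hc.aestronglyMeasurable]
  simpa only [Complex.norm_real, Real.norm_eq_abs, sq_abs] using h

theorem integrable_solution_mul {a b : ℕ → ℝ} {n : ℕ}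
    (h : Integrable (fun x => solution a b 0 x n ^ 2) μ) {g : ℝ → ℂ} (hg : MemLp g 2 μ) :
    Integrable (fun x => (solution a b 0 x n : ℂ) * g x) μ :=
  (memLp_solution h).integrable_mul hg

/-- Multiplication by `x` acts on expansion coefficients as the Jacobi matrix. The separate `g'`
allows `x g` to be given in a rewritten form. -/
theorem integral_recurrence {a b : ℕ → ℝ} (ha : ∀ n, a n ≠ 0)
    (hsq : ∀ n, Integrable (fun x => solution a b 0 x n ^ 2) μ) {g g' : ℝ → ℂ}
    (hg : MemLp g 2 μ) (hg' : g' =ᵐ[μ] fun x => x * g x) (n : ℕ) :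
    a (n + 1) * ∫ x, solution a b 0 x (n + 2) * g x ∂μ
      + a n * ∫ x, solution a b 0 x n * g x ∂μ
      + b (n + 1) * ∫ x, solution a b 0 x (n + 1) * g x ∂μ
      = ∫ x, solution a b 0 x (n + 1) * g' x ∂μ := by
  have hi := fun n => integrable_solution_mul (hsq n) hg
  have h1 := (hi (n + 2)).const_mul (a (n + 1) : ℂ)
  have h2 := (hi n).const_mul (a n : ℂ)
  have h3 := (hi (n + 1)).const_mul (b (n + 1) : ℂ)
  rw [← integral_const_mul, ← integral_const_mul, ← integral_const_mul, ← integral_add h1 h2,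
    ← integral_add (by exact h1.add h2) h3]
  refine integral_congr_ae ?_
  filter_upwards [hg'] with x hx
  rw [hx]
  have : (x : ℂ) * solution a b 0 x (n + 1) = a (n + 1) * solution a b 0 x (n + 2)
      + a n * solution a b 0 x n + b (n + 1) * solution a b 0 x (n + 1) := by
    exact_mod_cast mul_solution_eq a b ha x n
  linear_combination -g x * this

theorem inner_toLp_solution {a b : ℕ → ℝ} {n : ℕ}
    (h : Integrable (fun x => solution a b 0 x n ^ 2) μ) (g : Lp ℂ 2 μ) :
    inner ℂ ((memLp_solution h).toLp) g = ∫ x, solution a b 0 x n * g x ∂μ := by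
  rw [L2.inner_def]
  refine integral_congr_ae ?_
  filter_upwards [(memLp_solution h).coeFn_toLp] with x hx
  rw [hx]
  simp [mul_comm]

theorem orthonormal_solution {a b : ℕ → ℝ}
    (hsq : ∀ n, Integrable (fun x => solution a b 0 x n ^ 2) μ)
    (horth : ∀ n m, ∫ x, solution a b 0 x (n + 1) * solution a b 0 x (m + 1) ∂μ
      = if n = m then 1 else 0) :
    Orthonormal ℂ fun n : ℕ => (memLp_solution (hsq (n + 1))).toLp := by
  rw [orthonormal_iff_ite]
  intro n m
  rw [inner_toLp_solution (hsq (n + 1))]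
  have h : ∫ x, solution a b 0 x (n + 1) *
      (MemLp.toLp _ (memLp_solution (hsq (m + 1))) : ℝ → ℂ) x ∂μ
      = ∫ x, ((solution a b 0 x (n + 1) * solution a b 0 x (m + 1) : ℝ) : ℂ) ∂μ := by
    refine integral_congr_ae ?_
    filter_upwards [(memLp_solution (hsq (m + 1))).coeFn_toLp] with x hx
    rw [hx]
    push_cast
    rfl
  rw [h, integral_complex_ofReal, horth]
  split_ifs <;> simp

/-- The orthogonal complement of the polynomials is invariant under the resolvent. -/
theorem integral_solution_mul_resolvent_eq_zero {a b : ℕ → ℝ} (ha : ∀ n, a n ≠ 0)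
    (hsum : ¬ Summable fun n => |a n|⁻¹)
    (hsq : ∀ n, Integrable (fun x => solution a b 0 x n ^ 2) μ)
    (horth : ∀ n m, ∫ x, solution a b 0 x (n + 1) * solution a b 0 x (m + 1) ∂μ
      = if n = m then 1 else 0)
    {g : ℝ → ℂ} (hg : MemLp g 2 μ) (h : ∀ n, ∫ x, solution a b 0 x n * g x ∂μ = 0)
    {z : ℂ} (hz : z.im ≠ 0) (n : ℕ) :
    ∫ x, solution a b 0 x n * (((x : ℂ) - z)⁻¹ * g x) ∂μ = 0 := by
  have hrg := (isBoundedBorel_resolvent hz).memLp_mul hg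
  refine eq_zero_of_summable_norm_sq (b := b)
    (φ := fun n => ∫ x, solution a b 0 x n * (((x : ℂ) - z)⁻¹ * g x) ∂μ) ha hsum hz
    (by simp [solution]) (fun k => ?_) ?_ n
  · rw [integral_recurrence ha hsq hrg (g' := fun x => g x + z * (((x : ℂ) - z)⁻¹ * g x))
      (ae_of_all _ fun x => by beta_reduce; linear_combination -g x * mul_resolvent hz x)]
    have hi1 := integrable_solution_mul (hsq (k + 1)) hg
    have hi2 := (integrable_solution_mul (hsq (k + 1)) hrg).const_mul z
    rw [← integral_const_mul]
    refine Eq.trans ?_ (zero_add _)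
    rw [← h (k + 1), ← integral_add hi1 hi2]
    exact integral_congr_ae (ae_of_all _ fun x => by ring)
  -- Bessel's inequality makes the coefficients of the resolvent image square summable; they solve
  -- the homogeneous equation because those of `g` vanish.
  · rw [← summable_nat_add_iff 1]
    refine ((orthonormal_solution hsq horth).inner_products_summable hrg.toLp).congr fun k => ?_
    rw [inner_toLp_solution (hsq (k + 1))]
    congr 2
    refine integral_congr_ae ?_
    filter_upwards [hrg.coeFn_toLp] with x hx
    rw [hx]

theorem integral_resolvent_pow_mul_eq_zero {a b : ℕ → ℝ} (ha : ∀ n, a n ≠ 0)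
    (hsum : ¬ Summable fun n => |a n|⁻¹)
    (hsq : ∀ n, Integrable (fun x => solution a b 0 x n ^ 2) μ)
    (horth : ∀ n m, ∫ x, solution a b 0 x (n + 1) * solution a b 0 x (m + 1) ∂μ
      = if n = m then 1 else 0)
    {g : ℝ → ℂ} (hg : MemLp g 2 μ) (h : ∀ n, ∫ x, solution a b 0 x n * g x ∂μ = 0)
    {z : ℂ} (hz : z.im ≠ 0) (p : ℕ) :
    ∫ x, ((x : ℂ) - z)⁻¹ ^ p * g x ∂μ = 0 := by
  have H : MemLp (fun x : ℝ => ((x : ℂ) - z)⁻¹ ^ p * g x) 2 μ ∧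
      ∀ n, ∫ x, solution a b 0 x n * (((x : ℂ) - z)⁻¹ ^ p * g x) ∂μ = 0 := by
    induction p with
    | zero => simpa using ⟨hg, h⟩
    | succ p ih =>
      simp only [pow_succ', mul_assoc]
      exact ⟨(isBoundedBorel_resolvent hz).memLp_mul ih.1, fun n =>
        integral_solution_mul_resolvent_eq_zero ha hsum hsq horth ih.1 ih.2 hz n⟩
  simpa [solution] using H.2 1

/-- Use `e^{itx} = lim (1 - itx/p)^{-p}`. For each `p > 0` the approximant is a multiple of the
`p`-th power of the resolvent function at `z = -ip/t`, and all have modulus at most one on the real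
line. -/
theorem integral_exp_mul_eq_zero [IsFiniteMeasure μ] {a b : ℕ → ℝ} (ha : ∀ n, a n ≠ 0)
    (hsum : ¬ Summable fun n => |a n|⁻¹)
    (hsq : ∀ n, Integrable (fun x => solution a b 0 x n ^ 2) μ)
    (horth : ∀ n m, ∫ x, solution a b 0 x (n + 1) * solution a b 0 x (m + 1) ∂μ
      = if n = m then 1 else 0)
    {g : ℝ → ℂ} (hg : MemLp g 2 μ) (h : ∀ n, ∫ x, solution a b 0 x n * g x ∂μ = 0) (t : ℝ) :
    ∫ x, Complex.exp (t * x * Complex.I) * g x ∂μ = 0 := by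
  rcases eq_or_ne t 0 with rfl | ht
  · simpa [solution] using h 1
  set q : ℕ → ℝ → ℂ := fun p x => 1 + (-(t * x * Complex.I)) / p
  have hq1 : ∀ p x, 1 ≤ ‖q p x‖ := fun p x => by
    refine le_trans (le_of_eq ?_) ((le_abs_self _).trans (Complex.abs_re_le_norm (q p x)))
    have : (-(t * x * Complex.I)) / p = ((-(t * x) / p : ℝ) : ℂ) * Complex.I := by
      push_cast; ring
    simp only [q, this]
    simp
  have hlim : ∀ x : ℝ, Tendsto (fun p : ℕ => (q p x)⁻¹ ^ p) atTop
      (𝓝 (Complex.exp (t * x * Complex.I))) := by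
    intro x
    have := (Complex.tendsto_one_add_div_pow_exp (-(t * x * Complex.I))).inv₀ (Complex.exp_ne_zero _)
    rw [← Complex.exp_neg, neg_neg] at this
    simpa only [inv_pow] using this
  have hT := tendsto_integral_of_dominated_convergence (μ := μ)
    (F := fun p x => (q p x)⁻¹ ^ p * g x) (fun x => ‖g x‖)
    (fun p => (Measurable.aestronglyMeasurable (by fun_prop)).mul hg.1)
    (hg.integrable one_le_two).norm
    (fun p => ae_of_all _ fun x => by
      rw [norm_mul, norm_pow, norm_inv]
      exact mul_le_of_le_one_left (norm_nonneg _)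
        (pow_le_one₀ (by positivity) (inv_le_one_of_one_le₀ (hq1 p x))))
    (ae_of_all _ fun x => (hlim x).mul_const _)
  refine tendsto_nhds_unique hT (tendsto_const_nhds.congr' ?_)
  filter_upwards [eventually_gt_atTop 0] with p hp
  have hp' : (p : ℝ) ≠ 0 := by exact_mod_cast hp.ne'
  have hpc : (p : ℂ) ≠ 0 := by exact_mod_cast hp.ne'
  have htc : (t : ℂ) ≠ 0 := by exact_mod_cast ht
  set z : ℂ := ((-(p / t) : ℝ) : ℂ) * Complex.I
  have hz : z.im ≠ 0 := by
    have : z.im = -(p / t) := by simp [z]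
    rw [this]
    exact neg_ne_zero.2 (div_ne_zero hp' ht)
  have hqz : ∀ x : ℝ, q p x = (-(t * Complex.I) / p) * ((x : ℂ) - z) := by
    intro x
    simp only [q, z]
    push_cast
    field_simp
    linear_combination (p : ℂ) * Complex.I_sq
  have : ∀ x : ℝ, (q p x)⁻¹ ^ p * g x
      = ((-(t * Complex.I) / p)⁻¹ ^ p) * (((x : ℂ) - z)⁻¹ ^ p * g x) := by
    intro x
    rw [hqz, mul_inv, mul_pow, mul_assoc]
  simp only [this]
  rw [integral_const_mul, integral_resolvent_pow_mul_eq_zero ha hsum hsq horth hg h hz, mul_zero]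

/-- The positive and negative parts of `g` define finite measures with equal characteristic
functions, hence equal measures and equal densities. -/
theorem ae_eq_zero_of_integral_exp_mul_eq_zero {g : ℝ → ℝ} (hgm : Measurable g)
    (hg : Integrable g μ)
    (h : ∀ t : ℝ, ∫ x, Complex.exp (t * x * Complex.I) * g x ∂μ = 0) : g =ᵐ[μ] 0 := by
  set p : ℝ → ℝ≥0∞ := fun x => ENNReal.ofReal (g x)
  set q : ℝ → ℝ≥0∞ := fun x => ENNReal.ofReal (-g x)
  have hpm : Measurable p := hgm.ennreal_ofReal
  have hqm : Measurable q := hgm.neg.ennreal_ofReal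
  have hpi : ∫⁻ x, p x ∂μ ≠ ⊤ := hg.lintegral_lt_top.ne
  have hqi : ∫⁻ x, q x ∂μ ≠ ⊤ := hg.neg.lintegral_lt_top.ne
  have := isFiniteMeasure_withDensity hpi
  have := isFiniteMeasure_withDensity hqi
  have hint : ∀ (t : ℝ) (k : ℝ → ℝ), Integrable k μ →
      Integrable (fun x => k x • Complex.exp (t * x * Complex.I)) μ := by
    intro t k hk
    refine hk.norm.mono' (hk.1.smul (Measurable.aestronglyMeasurable (by fun_prop)))
      (ae_of_all _ fun x => ?_)
    rw [norm_smul, ← Complex.ofReal_mul, Complex.norm_exp_ofReal_mul_I, mul_one]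
  have hchar : charFun (μ.withDensity p) = charFun (μ.withDensity q) := by
    funext t
    rw [charFun_apply_real, charFun_apply_real,
      integral_withDensity_eq_integral_toReal_smul hpm (ae_of_all _ fun _ => ENNReal.ofReal_lt_top),
      integral_withDensity_eq_integral_toReal_smul hqm (ae_of_all _ fun _ => ENNReal.ofReal_lt_top),
      ← sub_eq_zero, ← integral_sub (hint t _ (integrable_toReal_of_lintegral_ne_top
        hpm.aemeasurable hpi)) (hint t _ (integrable_toReal_of_lintegral_ne_top
        hqm.aemeasurable hqi)), ← h t]
    refine integral_congr_ae (ae_of_all _ fun x => ?_)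
    simp only [p, q]
    rw [ENNReal.toReal_ofReal', ENNReal.toReal_ofReal', ← sub_smul, max_zero_sub_max_neg_zero_eq_self,
      Complex.real_smul, mul_comm]
  have heq := (withDensity_eq_iff hpm.aemeasurable hqm.aemeasurable hpi).1
    (Measure.ext_of_charFun hchar)
  filter_upwards [heq] with x hx
  simp only [p, q] at hx
  rcases le_total 0 (g x) with h0 | h0
  · rw [ENNReal.ofReal_of_nonpos (neg_nonpos.2 h0), ENNReal.ofReal_eq_zero] at hx
    exact le_antisymm hx h0
  · rw [ENNReal.ofReal_of_nonpos h0, eq_comm, ENNReal.ofReal_eq_zero] at hx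
    exact le_antisymm h0 (neg_nonpos.1 hx)

/-- The polynomials are real, so orthogonality passes to the real and imaginary parts of `g`, where
uniqueness of the Fourier transform applies. -/
theorem ae_eq_zero_of_integral_solution_mul_eq_zero [IsFiniteMeasure μ] {a b : ℕ → ℝ}
    (ha : ∀ n, a n ≠ 0) (hsum : ¬ Summable fun n => |a n|⁻¹)
    (hsq : ∀ n, Integrable (fun x => solution a b 0 x n ^ 2) μ)
    (horth : ∀ n m, ∫ x, solution a b 0 x (n + 1) * solution a b 0 x (m + 1) ∂μ
      = if n = m then 1 else 0)
    {g : ℝ → ℂ} (hgm : Measurable g) (hg : MemLp g 2 μ)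
    (h : ∀ n, ∫ x, solution a b 0 x n * g x ∂μ = 0) : g =ᵐ[μ] 0 := by
  have hi := fun n => integrable_solution_mul (hsq n) hg
  have hre : (fun x => (g x).re) =ᵐ[μ] 0 := by
    refine ae_eq_zero_of_integral_exp_mul_eq_zero (Complex.measurable_re.comp hgm)
      (hg.integrable one_le_two).re fun t => ?_
    refine integral_exp_mul_eq_zero ha hsum hsq horth hg.re.ofReal (fun n => ?_) t
    have := congrArg Complex.re (h n)
    rw [← RCLike.re_eq_complex_re, ← integral_re (hi n)] at this
    change ∫ x, (solution a b 0 x n : ℂ) * (((g x).re : ℝ) : ℂ) ∂μ = 0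
    simp only [← Complex.ofReal_mul]
    rw [integral_complex_ofReal]
    simpa using this
  have him : (fun x => (g x).im) =ᵐ[μ] 0 := by
    refine ae_eq_zero_of_integral_exp_mul_eq_zero (Complex.measurable_im.comp hgm)
      (hg.integrable one_le_two).im fun t => ?_
    refine integral_exp_mul_eq_zero ha hsum hsq horth hg.im.ofReal (fun n => ?_) t
    have := congrArg Complex.im (h n)
    rw [← RCLike.im_eq_complex_im, ← integral_im (hi n)] at this
    change ∫ x, (solution a b 0 x n : ℂ) * (((g x).im : ℝ) : ℂ) ∂μ = 0
    simp only [← Complex.ofReal_mul]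
    rw [integral_complex_ofReal]
    simpa using this
  filter_upwards [hre, him] with x h1 h2
  exact Complex.ext h1 h2

end Completeness

theorem exists_hilbertBasis_solution {a b : ℕ → ℝ} (ha : ∀ n, a n ≠ 0)
    (hsum : ¬ Summable fun n => |a n|⁻¹) :
    ∃ μ : Measure ℝ, IsProbabilityMeasure μ ∧
      (∀ n, Integrable (fun x => solution a b 0 x n ^ 2) μ) ∧
      ∃ B : HilbertBasis ℕ+ ℂ (Lp ℂ 2 μ), ∀ (g : Lp ℂ 2 μ) (n : ℕ),
        zeroExtend (B.repr g) n = ∫ x, solution a b 0 x n * g x ∂μ := by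
  obtain ⟨μ, hμ, hsq, horth⟩ := exists_orthogonality_measure a b ha
  set e : ℕ+ → Lp ℂ 2 μ := fun n => (memLp_solution (hsq (n.natPred + 1))).toLp
  have he : Orthonormal ℂ e := (orthonormal_solution hsq horth).comp _ PNat.natPred_injective
  have hbot : (Submodule.span ℂ (Set.range e))ᗮ = ⊥ := by
    rw [eq_bot_iff]
    intro g hg
    rw [Submodule.mem_bot, Lp.eq_zero_iff_ae_eq_zero]
    refine ae_eq_zero_of_integral_solution_mul_eq_zero ha hsum hsq horth
      (Lp.stronglyMeasurable g).measurable (Lp.memLp g) fun n => ?_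
    rcases n with _ | n
    · simp [solution]
    · rw [← inner_toLp_solution (hsq (n + 1))]
      exact (Submodule.mem_orthogonal _ _).1 hg _ (Submodule.subset_span ⟨n.succPNat, rfl⟩)
  refine ⟨μ, hμ, hsq, HilbertBasis.mkOfOrthogonalEqBot he hbot, fun g n => ?_⟩
  rcases n with _ | n
  · simp [solution]
  · rw [← inner_toLp_solution (hsq (n + 1))]
    refine (zeroExtend_coe _ n.succPNat).trans ?_
    rw [HilbertBasis.repr_apply_apply, HilbertBasis.coe_mkOfOrthogonalEqBot]
    rfl

/-! ### Multiplication operators -/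

section Multiplication

variable (μ : Measure ℝ)

open Classical in
/-- Multiplication by the bounded Borel function `f` on `L²(μ)`. -/
noncomputable def multiplication (f : ℝ → ℂ) : Lp ℂ 2 μ →L[ℂ] Lp ℂ 2 μ :=
  if hf : IsBoundedBorel f then
    LinearMap.mkContinuousOfExistsBound
      { toFun := fun g => (hf.memLp_mul (Lp.memLp g)).toLp
        map_add' := fun g h => by
          apply Lp.ext
          filter_upwards [(hf.memLp_mul (Lp.memLp (g + h))).coeFn_toLp,
            (hf.memLp_mul (Lp.memLp g)).coeFn_toLp, (hf.memLp_mul (Lp.memLp h)).coeFn_toLp,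
            Lp.coeFn_add g h, Lp.coeFn_add (hf.memLp_mul (Lp.memLp g)).toLp
              (hf.memLp_mul (Lp.memLp h)).toLp] with x h1 h2 h3 h4 h5
          rw [h1, h5, Pi.add_apply, h2, h3, h4, Pi.add_apply, mul_add]
        map_smul' := fun c g => by
          apply Lp.ext
          filter_upwards [(hf.memLp_mul (Lp.memLp (c • g))).coeFn_toLp,
            (hf.memLp_mul (Lp.memLp g)).coeFn_toLp, Lp.coeFn_smul c g,
            Lp.coeFn_smul c (hf.memLp_mul (Lp.memLp g)).toLp] with x h1 h2 h3 h4
          rw [h1, RingHom.id_apply, h4, Pi.smul_apply, h2, h3, Pi.smul_apply, smul_eq_mul,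
            smul_eq_mul, mul_left_comm] }
      (by
        obtain ⟨M, hM⟩ := hf.2
        refine ⟨M, fun g => Lp.norm_le_mul_norm_of_ae_le_mul ?_⟩
        filter_upwards [(hf.memLp_mul (Lp.memLp g)).coeFn_toLp] with x hx
        refine (le_of_eq (congrArg norm hx)).trans ?_
        rw [norm_mul]
        exact mul_le_mul_of_nonneg_right (hM x) (norm_nonneg _))
  else 0

variable {μ}

theorem coeFn_multiplication {f : ℝ → ℂ} (hf : IsBoundedBorel f) (g : Lp ℂ 2 μ) :
    multiplication μ f g =ᵐ[μ] fun x => f x * g x := by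
  rw [multiplication, dif_pos hf]
  exact (hf.memLp_mul (Lp.memLp g)).coeFn_toLp

theorem norm_multiplication_le {f : ℝ → ℂ} (hfm : Measurable f) {M : ℝ} (hM : ∀ x, ‖f x‖ ≤ M) :
    ‖multiplication μ f‖ ≤ M := by
  refine ContinuousLinearMap.opNorm_le_bound _ ((norm_nonneg _).trans (hM 0)) fun g => ?_
  refine Lp.norm_le_mul_norm_of_ae_le_mul ?_
  filter_upwards [coeFn_multiplication ⟨hfm, M, hM⟩ g] with x hx
  rw [hx, norm_mul]
  exact mul_le_mul_of_nonneg_right (hM x) (norm_nonneg _)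

theorem multiplication_one : multiplication μ (fun _ => 1) = 1 := by
  refine ContinuousLinearMap.ext fun g => Lp.ext ?_
  filter_upwards [coeFn_multiplication (isBoundedBorel_const 1) g] with x hx
  rw [hx, one_mul, one_apply_eq_self]

theorem multiplication_add {f g : ℝ → ℂ} (hf : IsBoundedBorel f) (hg : IsBoundedBorel g) :
    multiplication μ (fun x => f x + g x) = multiplication μ f + multiplication μ g := by
  refine ContinuousLinearMap.ext fun k => Lp.ext ?_
  rw [add_apply]
  filter_upwards [coeFn_multiplication (hf.add hg) k, coeFn_multiplication hf k,
    coeFn_multiplication hg k, Lp.coeFn_add (multiplication μ f k) (multiplication μ g k)]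
    with x h1 h2 h3 h4
  rw [h1, h4, Pi.add_apply, h2, h3, add_mul]

theorem multiplication_const_mul (c : ℂ) {f : ℝ → ℂ} (hf : IsBoundedBorel f) :
    multiplication μ (fun x => c * f x) = c • multiplication μ f := by
  refine ContinuousLinearMap.ext fun k => Lp.ext ?_
  rw [smul_apply]
  filter_upwards [coeFn_multiplication (hf.const_mul c) k, coeFn_multiplication hf k,
    Lp.coeFn_smul c (multiplication μ f k)] with x h1 h2 h3
  rw [h1, h3, Pi.smul_apply, h2, smul_eq_mul, mul_assoc]

theorem multiplication_mul {f g : ℝ → ℂ} (hf : IsBoundedBorel f) (hg : IsBoundedBorel g) :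
    multiplication μ (fun x => f x * g x) = multiplication μ f * multiplication μ g := by
  refine ContinuousLinearMap.ext fun k => Lp.ext ?_
  rw [mul_apply_eq_comp]
  filter_upwards [coeFn_multiplication (hf.mul hg) k, coeFn_multiplication hg k,
    coeFn_multiplication hf (multiplication μ g k)] with x h1 h2 h3
  rw [h1, h3, h2, mul_assoc]

theorem inner_multiplication_conj {f : ℝ → ℂ} (hf : IsBoundedBorel f) (g h : Lp ℂ 2 μ) :
    inner ℂ (multiplication μ (fun x => (starRingEnd ℂ) (f x)) g) h
      = inner ℂ g (multiplication μ f h) := by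
  rw [L2.inner_def, L2.inner_def]
  refine integral_congr_ae ?_
  filter_upwards [coeFn_multiplication hf.conj g, coeFn_multiplication hf h] with x h1 h2
  rw [h1, h2]
  simp only [RCLike.inner_apply, map_mul, Complex.conj_conj]
  ring

theorem norm_sq_eq_integral (g : Lp ℂ 2 μ) : ‖g‖ ^ 2 = ∫ x, ‖g x‖ ^ 2 ∂μ := by
  have h := L2.inner_def (𝕜 := ℂ) g g
  simp only [inner_self_eq_norm_sq_to_K] at h
  rw [← Complex.ofReal_inj, ← integral_complex_ofReal]
  push_cast
  exact h

/-- Dominated convergence for products in `L²`. -/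
theorem tendsto_of_dominated_mul {h : ℕ → ℝ → ℂ} {f : ℝ → ℂ} {w : ℝ → ℝ} {g : Lp ℂ 2 μ}
    {F : ℕ → Lp ℂ 2 μ} {G : Lp ℂ 2 μ} (hle : ∀ n x, ‖h n x‖ ≤ w x)
    (hlim : ∀ x, Tendsto (fun n => h n x) atTop (𝓝 (f x)))
    (hw : Integrable (fun x => (w x * ‖g x‖) ^ 2) μ)
    (hF : ∀ n, F n =ᵐ[μ] fun x => h n x * g x) (hG : G =ᵐ[μ] fun x => f x * g x) :
    Tendsto F atTop (𝓝 G) := by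
  have hfw : ∀ x, ‖f x‖ ≤ w x := fun x => le_of_tendsto (hlim x).norm
    (Eventually.of_forall fun n => hle n x)
  have hcoe : ∀ n, (F n - G : Lp ℂ 2 μ) =ᵐ[μ] fun x => (h n x - f x) * g x := fun n => by
    filter_upwards [Lp.coeFn_sub (F n) G, hF n, hG] with x h1 h2 h3
    rw [h1, Pi.sub_apply, h2, h3, sub_mul]
  have hsq : Tendsto (fun n => ‖F n - G‖ ^ 2) atTop (𝓝 0) := by
    simp only [norm_sq_eq_integral]
    have h0 : ∫ x, ‖(0 : ℂ)‖ ^ 2 ∂μ = 0 := by simp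
    rw [← h0]
    -- Both `h n` and its limit are bounded by `w`, so the difference is at most `2w`; hence the
    -- factor 4.
    refine tendsto_integral_of_dominated_convergence (fun x => 4 * (w x * ‖g x‖) ^ 2)
      (fun n => (Lp.aestronglyMeasurable _).norm.pow 2) (hw.const_mul 4) (fun n => ?_) ?_
    · filter_upwards [hcoe n] with x hx
      rw [hx, norm_mul, Real.norm_of_nonneg (by positivity), mul_pow, mul_pow, ← mul_assoc]
      gcongr
      have := (norm_sub_le (h n x) (f x)).trans (add_le_add (hle n x) (hfw x))
      nlinarith [norm_nonneg (h n x - f x)]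
    · have hall := ae_all_iff.2 hcoe
      filter_upwards [hall] with x hx
      have ht : Tendsto (fun n => (h n x - f x) * g x) atTop (𝓝 0) := by
        have := ((hlim x).sub_const (f x)).mul_const (g x)
        rwa [sub_self, zero_mul] at this
      exact (ht.norm.pow 2).congr fun n => by rw [hx n]
  rw [tendsto_iff_norm_sub_tendsto_zero]
  have := hsq.sqrt
  simpa using this

end Multiplication

/-! ### The functional calculus of a Jacobi operator -/

/-- On the domain, the expansion diagonalizes the Jacobi operator. -/
theorem exists_mul_eq_jacobiOperator {a b : ℕ → ℝ} (ha : ∀ n, a n ≠ 0)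
    (hsum : ¬ Summable fun n => |a n|⁻¹) {μ : Measure ℝ}
    (hsq : ∀ n, Integrable (fun x => solution a b 0 x n ^ 2) μ) {B : HilbertBasis ℕ+ ℂ (Lp ℂ 2 μ)}
    (hB : ∀ (g : Lp ℂ 2 μ) (n : ℕ), zeroExtend (B.repr g) n = ∫ x, solution a b 0 x n * g x ∂μ)
    (ψ : (jacobiOperator a b).domain) :
    ∃ F : Lp ℂ 2 μ, (F =ᵐ[μ] fun x => x * B.repr.symm (ψ : HalfLine) x) ∧
      B.repr F = jacobiOperator a b ψ := by
  have hI : Complex.I.im ≠ 0 := by simp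
  have hr := isBoundedBorel_resolvent hI
  set η : HalfLine := jacobiOperator a b ψ - Complex.I • (ψ : HalfLine) with hη
  set K : Lp ℂ 2 μ := B.repr.symm η with hK
  -- `G` is the preimage of `ψ` that the resolvent at `i` predicts from `η = (H - i)ψ`.
  set G := multiplication μ (fun x : ℝ => ((x : ℂ) - Complex.I)⁻¹) K with hG
  set F := K + Complex.I • G with hFdef
  have hFG : F =ᵐ[μ] fun x => x * G x := by
    filter_upwards [coeFn_multiplication hr K, Lp.coeFn_add K (Complex.I • G),
      Lp.coeFn_smul Complex.I G] with x h1 h2 h3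
    rw [h2, Pi.add_apply, h3, Pi.smul_apply, smul_eq_mul, h1]
    linear_combination -K x * mul_resolvent hI x
  have hadd : ∀ (u v : HalfLine) n, zeroExtend ((u + v : HalfLine) : ℕ+ → ℂ) n
      = zeroExtend u n + zeroExtend v n := fun u v n => by
    simp only [← inner_unitVector, inner_add_right]
  have hsmul : ∀ (c : ℂ) (v : HalfLine) n, zeroExtend ((c • v : HalfLine) : ℕ+ → ℂ) n
      = c * zeroExtend v n := fun c v n => by
    simp only [← inner_unitVector, inner_smul_right]
  have hFη : B.repr F = η + Complex.I • B.repr G := by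
    rw [hFdef, map_add, map_smul, hK, LinearIsometryEquiv.apply_symm_apply]
  have hrec1 : ∀ n, a (n + 1) * zeroExtend (B.repr G) (n + 2) + a n * zeroExtend (B.repr G) n
      + b (n + 1) * zeroExtend (B.repr G) (n + 1)
      = zeroExtend η (n + 1) + Complex.I * zeroExtend (B.repr G) (n + 1) := by
    intro n
    rw [← hsmul Complex.I, ← hadd, ← hFη, hB, hB, hB, hB]
    exact integral_recurrence ha hsq (Lp.memLp G) hFG n
  have hHψ : jacobiOperator a b ψ = η + Complex.I • (ψ : HalfLine) := by rw [hη]; abel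
  have hrec2 : ∀ n, a (n + 1) * zeroExtend (ψ : HalfLine) (n + 2)
      + a n * zeroExtend (ψ : HalfLine) n + b (n + 1) * zeroExtend (ψ : HalfLine) (n + 1)
      = zeroExtend η (n + 1) + Complex.I * zeroExtend (ψ : HalfLine) (n + 1) := by
    intro n
    rw [← hsmul Complex.I, ← hadd, ← hHψ]
    exact (zeroExtend_coe (jacobiOperator a b ψ : HalfLine) n.succPNat).symm
  -- `ψ` and the image of `G` solve the same inhomogeneous equation, so their difference is an `ℓ²`
  -- solution at energy `i` and vanishes. This shows that the maximal domain is not too large.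
  have hzero := eq_zero_of_summable_norm_sq (b := b) ha hsum hI
    (φ := fun n => zeroExtend ((ψ : HalfLine) - B.repr G : HalfLine) n)
    (zeroExtend_zero_right _) (fun n => by
      simp only [← inner_unitVector, inner_sub_right]
      simp only [inner_unitVector]
      linear_combination hrec2 n - hrec1 n) (by
      refine summable_of_sum_range_le (c := ‖((ψ : HalfLine) - B.repr G : HalfLine)‖ ^ 2)
        (fun n => sq_nonneg _) fun n => ?_
      refine le_trans ?_ (sum_norm_zeroExtend_sq_le ((ψ : HalfLine) - B.repr G : HalfLine) n)
      rw [← Finset.Ico_add_one_right_eq_Icc]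
      rcases n with _ | n
      · simp
      · rw [Finset.sum_range_eq_add_Ico _ (by omega), zeroExtend_zero_right, norm_zero]
        simp only [ne_eq, OfNat.ofNat_ne_zero, not_false_eq_true, zero_pow, zero_add]
        exact Finset.sum_le_sum_of_subset_of_nonneg (Finset.Ico_subset_Ico_right (by omega))
          fun _ _ _ => sq_nonneg _)
  have hψG : (ψ : HalfLine) = B.repr G := by
    rw [← sub_eq_zero]
    refine lp.ext (funext fun n => ?_)
    exact (zeroExtend_coe _ n).symm.trans (hzero n)
  refine ⟨F, ?_, ?_⟩
  · rw [hψG, LinearIsometryEquiv.symm_apply_apply]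
    exact hFG
  · rw [hFη, ← hψG, hHψ]

/-- The spectral theorem for half-line Jacobi operators satisfying Carleman's condition. -/
theorem exists_isBorelFunctionalCalculus_jacobiOperator {a b : ℕ → ℝ} (ha : ∀ n, a n ≠ 0)
    (hsum : ¬ Summable fun n => |a n|⁻¹) :
    ∃ Φ, IsBorelFunctionalCalculus (jacobiOperator a b) Φ := by
  obtain ⟨μ, hμ, hsq, B, hB⟩ := exists_hilbertBasis_solution (b := b) ha hsum
  set V : Lp ℂ 2 μ →L[ℂ] HalfLine := (B.repr.toContinuousLinearEquiv : Lp ℂ 2 μ →L[ℂ] HalfLine)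
  set W : HalfLine →L[ℂ] Lp ℂ 2 μ :=
    (B.repr.symm.toContinuousLinearEquiv : HalfLine →L[ℂ] Lp ℂ 2 μ)
  set Φ : (ℝ → ℂ) → HalfLine →L[ℂ] HalfLine := fun f => V ∘L multiplication μ f ∘L W
  have hΦ : ∀ f ψ, Φ f ψ = B.repr (multiplication μ f (B.repr.symm ψ)) := fun _ _ => rfl
  refine ⟨Φ, ?_, fun f g hf hg => ?_, fun c f hf => ?_, fun f g hf hg => ?_, fun f hf => ?_,
    fun f M hfm hM => ?_, fun h f M hhm hfm hM hlim ψ => ?_, fun h hb hle hlim ψ => ?_⟩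
  · ext1 ψ
    rw [hΦ, multiplication_one, one_apply_eq_self, one_apply_eq_self,
      LinearIsometryEquiv.apply_symm_apply]
  · ext1 ψ
    rw [hΦ, multiplication_add hf hg, add_apply, map_add, add_apply, hΦ, hΦ]
  · ext1 ψ
    rw [hΦ, multiplication_const_mul c hf, smul_apply, map_smul, smul_apply, hΦ]
  · ext1 ψ
    rw [hΦ, multiplication_mul hf hg, mul_apply_eq_comp, mul_apply_eq_comp, hΦ, hΦ,
      LinearIsometryEquiv.symm_apply_apply]
  · rw [ContinuousLinearMap.eq_adjoint_iff]
    intro ψ χ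
    rw [hΦ, hΦ]
    nth_rewrite 1 [← B.repr.apply_symm_apply χ]
    rw [LinearIsometryEquiv.inner_map_map, inner_multiplication_conj hf,
      ← LinearIsometryEquiv.inner_map_map B.repr, LinearIsometryEquiv.apply_symm_apply]
  · refine ContinuousLinearMap.opNorm_le_bound _ ((norm_nonneg _).trans (hM 0)) fun ψ => ?_
    rw [hΦ, LinearIsometryEquiv.norm_map, ← B.repr.symm.norm_map ψ]
    exact ContinuousLinearMap.le_of_opNorm_le _ (norm_multiplication_le hfm hM) _
  · simp only [hΦ]
    refine (B.repr.continuous.tendsto _).comp ?_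
    have hfM : ∀ x, ‖f x‖ ≤ M := fun x => le_of_tendsto (hlim x).norm
      (Eventually.of_forall fun n => hM n x)
    refine tendsto_of_dominated_mul (w := fun _ => M) hM hlim ?_
      (fun n => coeFn_multiplication ⟨hhm n, M, hM n⟩ _) (coeFn_multiplication ⟨hfm, M, hfM⟩ _)
    simp only [mul_pow]
    exact ((memLp_two_iff_integrable_sq_norm (Lp.aestronglyMeasurable _)).1
      (Lp.memLp _)).const_mul _
  · obtain ⟨F, hF, hFψ⟩ := exists_mul_eq_jacobiOperator ha hsum hsq hB ψ
    simp only [hΦ, ← hFψ]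
    refine (B.repr.continuous.tendsto _).comp ?_
    -- The majorant `|x|` is unbounded, but `|x| |g| = |F|` almost everywhere is square integrable
    -- because `ψ` lies in the domain.
    refine tendsto_of_dominated_mul (w := fun x => |x|) hle hlim ?_
      (fun n => coeFn_multiplication (hb n) _) hF
    refine ((memLp_two_iff_integrable_sq_norm (Lp.aestronglyMeasurable _)).1
      (Lp.memLp F)).congr ?_
    filter_upwards [hF] with x hx
    rw [hx, norm_mul, Complex.norm_real, Real.norm_eq_abs]

end JacobiDynamics

theorem theorem1p3 :
    ∃ C : ℝ, 0 < C ∧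
      ∀ (a b : ℕ → ℝ), (∀ n, a n ≠ 0) → a 0 = 1 → ¬ Summable (fun n => |a n|⁻¹) →
      ∀ S : Set ℝ, MeasurableSet S → ∀ T L : ℝ, 0 < T → 0 < L →
        JacobiDynamics.timeAverage
            (fun t => JacobiDynamics.normSqUpTo
              (JacobiDynamics.zeroExtend
                (JacobiDynamics.evolution (JacobiDynamics.jacobiOperator a b) t
                  (JacobiDynamics.spectralProjection (JacobiDynamics.jacobiOperator a b) S
                    JacobiDynamics.deltaOne) : JacobiDynamics.HalfLine)) L) T
          ≤ ENNReal.ofReal C *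
            ∫⁻ E in S, ENNReal.ofReal
              (JacobiDynamics.normSqUpTo (JacobiDynamics.solution a b 0 E) L /
                JacobiDynamics.normSqUpTo (JacobiDynamics.solution a b 0 E)
                  (JacobiDynamics.lengthScale a b T⁻¹ E))
              ∂(JacobiDynamics.spectralMeasure (JacobiDynamics.jacobiOperator a b)
                JacobiDynamics.deltaOne) := by
  refine ⟨9, by norm_num, fun a b ha ha0 hsum S hS T L hT hL => ?_⟩
  -- Without existence, `borelCalculus` would be its default value zero. The estimate needs only the
  -- axioms of a calculus, not its uniqueness.
  have hH := JacobiDynamics.isBorelFunctionalCalculus_borelCalculus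
    (JacobiDynamics.exists_isBorelFunctionalCalculus_jacobiOperator (b := b) ha hsum)
  exact JacobiDynamics.timeAverage_le hH ha ha0 hsum hS hT hL.le
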